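/- All graphs are finite and simple. A graph $G$ is $\beta$-tough ($\beta$ real) if for every integer $p\ge 2$ it cannot be split into $p$ connected components by deleting fewer than $p\beta$ vertices, i.e. $|S|\ge p\beta$ whenever $S\subseteq V(G)$ and $G-S$ has exactly $p\ge 2$ components. $G$ is 5-chordal if every cycle of length at least $5$ in $G$ has a chord. Two edges of $G$ are remote if they are disjoint and no edge of $G$ joins an endpoint of one to an endpoint of the other. For an edge $e=uv$ its degree is $d(e)=|(N_G(u)\cup N_G(v))\setminus\{u,v\}|$. $G$ is prism-Hamiltonian if the Cartesian product of $G$ with $K_2$ has a Hamiltonian cycle. Corollary. Let $\epsilon>0$ and let $G$ be a $(1+\epsilon)$-tough 5-chordal graph with at least two vertices such that $d(e_1)+d(e_2)>|V(G)|-4$ for every pair of remote edges $e_1,e_2$ of $G$. Then $G$ is prism-Hamiltonian. -/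

import Mathlib

namespace SimpleGraph

/-- `G` is `β`-tough: for every `p ≥ 2`, splitting `G` into `p` components requires the deletion of
at least `p * β` vertices. -/
def IsTough {V : Type*} [Fintype V] (G : SimpleGraph V) (β : ℝ) : Prop :=
  ∀ p : ℕ, 2 ≤ p → ∀ S : Finset V,
    Nat.card (G.induce {v : V | v ∉ S}).ConnectedComponent = p → (p : ℝ) * β ≤ (S.card : ℝ)

/-- `G` is `k`-chordal: every cycle of length at least `k` has a chord. -/
def IsKChordal {V : Type*} (G : SimpleGraph V) (k : ℕ) : Prop :=
  ∀ (v : V) (c : G.Walk v v), c.IsCycle → k ≤ c.length → ∃ e : Sym2 V, c.IsChord e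

/-- Two edges are remote if they are disjoint and no edge joins them. -/
def AreRemoteEdges {V : Type*} (G : SimpleGraph V) (e₁ e₂ : Sym2 V) : Prop :=
  e₁ ∈ G.edgeSet ∧ e₂ ∈ G.edgeSet ∧ ∀ u ∈ e₁, ∀ v ∈ e₂, u ≠ v ∧ ¬ G.Adj u v

/-- The degree `|(N(u) ∪ N(v)) \ {u, v}|` of the edge `e = uv`. -/
noncomputable def edgeDegree {V : Type*} (G : SimpleGraph V) (e : Sym2 V) : ℕ :=
  Set.ncard {w : V | (∃ u ∈ e, G.Adj u w) ∧ w ∉ e}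

/-- The prism over `G`: the Cartesian product of `G` with `K₂`. -/
def prism {V : Type*} (G : SimpleGraph V) : SimpleGraph (V × Fin 2) :=
  G.boxProd (completeGraph (Fin 2))

/-- `G` is prism-Hamiltonian if the prism over `G` has a Hamiltonian cycle. -/
def IsPrismHamiltonian {V : Type*} [Fintype V] [DecidableEq V] (G : SimpleGraph V) : Prop :=
  G.prism.IsHamiltonian

end SimpleGraph

/-! Toughness is used only in strict form: if deleting S leaves at least two components, it leaves
fewer than |S|. For a nonempty independent set T this gives |N(T)| ≥ |T| + 1, and even |T| + 2
unless T ∪ N(T) is everything. Hence a graph on at least three vertices is not bipartite, and its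
shortest odd cycle, being chordless, is a triangle xyz by 5-chordality.

To get a Hamiltonian cycle of the prism it suffices to have an even cycle whose outside vertices are
independent. Hall's theorem matches these vertices into the cycle; then one runs round the cycle,
changing level at each vertex by a detour through its pendant vertex. An odd cycle would close at
the wrong level. This is repaired by a second odd cycle sharing one vertex
(`isPrismHamiltonian_of_two_odd_cycles`) or by a triangle with two vertices on the cycle
(`isPrismHamiltonian_of_theta`).

The degree condition gives a cycle C of G - x meeting all edges of G - x: take C with fewest
uncovered edges. If H is a nontrivial component of G - x - C, the successors on C of the neighbours
of H, each with a suitable partner, form remote edges. A crossing argument bounds their degree sums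
(`IsCyclicList.remote_partners`). Only a configuration on nine vertices survives, and toughness
excludes it.

Such a C contains y or z, and is odd, as otherwise x can hang on it. If it contains both, the
triangle repair works unless exactly |C| vertices other than x lie off C; then three neighbours of
one such vertex have successors with disjoint neighbourhoods that are too large. If no such C
contains both and z is missed, the same count makes x adjacent to a successor, which gives an even
cycle or two odd cycles meeting in y or z, whichever lies on C. -/

namespace SimpleGraph

/-! ### Paths and cycles as lists of vertices. -/

/-- `L` is a nonempty list of vertices from `a` to `b` whose consecutive entries are adjacent. -/
def ChainFromTo {α : Type*} (G : SimpleGraph α) (a : α) (L : List α) (b : α) : Prop :=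
  L.head? = some a ∧ L.getLast? = some b ∧ L.IsChain G.Adj

/-- `C` lists the vertices of a cycle in cyclic order; a single edge is admitted as a cycle. -/
def IsCyclicList {α : Type*} (G : SimpleGraph α) (C : List α) : Prop :=
  C.Nodup ∧ ∃ a b, G.ChainFromTo a C b ∧ G.Adj b a

namespace ChainFromTo

variable {α : Type*} {G : SimpleGraph α} {a b c d : α} {L M : List α}

theorem ne_nil (h : G.ChainFromTo a L b) : L ≠ [] := by
  rintro rfl; simp [ChainFromTo] at h

theorem singleton (a : α) : G.ChainFromTo a [a] a := by simp [ChainFromTo]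

theorem head_mem (h : G.ChainFromTo a L b) : a ∈ L := List.mem_of_mem_head? h.1

theorem last_mem (h : G.ChainFromTo a L b) : b ∈ L := List.mem_of_getLast? h.2.1

theorem append (h : G.ChainFromTo a L b) (h' : G.ChainFromTo c M d) (hbc : G.Adj b c) :
    G.ChainFromTo a (L ++ M) d := by
  obtain ⟨h1, h2, h3⟩ := h
  obtain ⟨k1, k2, k3⟩ := h'
  refine ⟨by simp [h1], by simp [k2], h3.append k3 ?_⟩
  intro x hx y hy
  simp_all

theorem cons (h : G.ChainFromTo a L b) (hc : G.Adj c a) : G.ChainFromTo c (c :: L) b :=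
  (singleton c).append h hc

theorem reverse (h : G.ChainFromTo a L b) : G.ChainFromTo b L.reverse a := by
  obtain ⟨h1, h2, h3⟩ := h
  refine ⟨by simp [h2], by simp [h1], ?_⟩
  rw [List.isChain_reverse]
  exact h3.imp fun _ _ h => h.symm

theorem exists_eq_cons (h : G.ChainFromTo a L b) : ∃ L', L = a :: L' := by
  obtain ⟨h1, -, -⟩ := h
  cases L with
  | nil => simp at h1
  | cons x L => simp at h1; exact ⟨L, by rw [h1]⟩

theorem exists_eq_concat (h : G.ChainFromTo a L b) : ∃ L', L = L' ++ [b] := by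
  obtain ⟨L', h'⟩ := h.reverse.exists_eq_cons
  exact ⟨L'.reverse, by simpa using congrArg List.reverse h'⟩

theorem tail (h : G.ChainFromTo a (a :: c :: L) b) :
    G.Adj a c ∧ G.ChainFromTo c (c :: L) b := by
  obtain ⟨h1, h2, h3⟩ := h
  rw [List.isChain_cons_cons] at h3
  exact ⟨h3.1, by simp, by simpa using h2, h3.2⟩

/-- Splitting between two consecutive entries. -/
theorem split (h : G.ChainFromTo a (L ++ c :: d :: M) b) :
    G.ChainFromTo a (L ++ [c]) c ∧ G.Adj c d ∧ G.ChainFromTo d (d :: M) b := by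
  obtain ⟨h1, h2, h3⟩ := h
  rw [List.isChain_append_cons_cons] at h3
  refine ⟨⟨?_, by simp, h3.1⟩, h3.2.1, ⟨by simp, by simpa using h2, h3.2.2⟩⟩
  cases L <;> simpa using h1

end ChainFromTo

namespace IsCyclicList

variable {α : Type*} {G : SimpleGraph α} {a b c d : α} {C L M : List α}

theorem mk' (h : G.ChainFromTo a C b) (hba : G.Adj b a) (hn : C.Nodup) : G.IsCyclicList C :=
  ⟨hn, a, b, h, hba⟩

theorem two_le_length (h : G.IsCyclicList C) : 2 ≤ C.length := by
  obtain ⟨-, a, b, h, hba⟩ := h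
  rcases C with _ | ⟨x, _ | ⟨y, C⟩⟩
  · simp [ChainFromTo] at h
  · simp [ChainFromTo] at h
    obtain ⟨rfl, rfl⟩ := h
    exact absurd hba (G.irrefl)
  · simp

/-- Rotation of a cyclic list so that it starts at a given split point. -/
theorem rotate_append (h : G.IsCyclicList (L ++ M)) : G.IsCyclicList (M ++ L) := by
  obtain ⟨hn, a, b, h, hba⟩ := h
  refine ⟨List.nodup_append_comm.1 hn, ?_⟩
  rcases L with _ | ⟨x, L⟩
  · exact ⟨a, b, by simpa using h, hba⟩
  rcases M with _ | ⟨y, M⟩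
  · exact ⟨a, b, by simpa using h, hba⟩
  obtain ⟨h1, h2, h3⟩ := h
  obtain ⟨k1, k2, k3⟩ := List.isChain_append.1 h3
  obtain ⟨z, hz⟩ : ∃ z, (x :: L).getLast? = some z := ⟨_, List.getLast?_eq_some_getLast (by simp)⟩
  simp only [List.cons_append, List.head?_cons, Option.some.injEq] at h1
  subst h1
  have h2' : (y :: M).getLast? = some b := by
    rw [List.getLast?_append] at h2
    rw [List.getLast?_eq_some_getLast (by simp)] at h2 ⊢
    simpa using h2
  refine ⟨y, z, ?_, k3 z hz y (by simp)⟩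
  exact ChainFromTo.append (b := b) (c := x) ⟨by simp, h2', k2⟩ ⟨by simp, hz, k1⟩ hba

/-- A cyclic list can be rotated so as to end at a given entry. -/
theorem exists_rotation_last (h : G.IsCyclicList C) (ha : a ∈ C) :
    ∃ c C', G.ChainFromTo c C' a ∧ G.Adj a c ∧ G.IsCyclicList C' ∧ C ~r C' := by
  obtain ⟨L, M, rfl⟩ := List.append_of_mem ha
  have h' : G.IsCyclicList (M ++ (L ++ [a])) := by
    apply rotate_append; simpa using h
  obtain ⟨hn, c, d, hc, hdc⟩ := id h'
  have hd : d = a := by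
    have := hc.2.1
    simp at this
    exact this.symm
  subst hd
  refine ⟨c, _, hc, hdc, h', ?_⟩
  have := List.isRotated_append (l := L ++ [d]) (l' := M)
  simpa using this

/-- A cyclic list can be rotated so as to start at a given entry. -/
theorem exists_rotation_first (h : G.IsCyclicList C) (ha : a ∈ C) :
    ∃ C', C ~r a :: C' ∧ G.IsCyclicList (a :: C') := by
  obtain ⟨L, M, rfl⟩ := List.append_of_mem ha
  refine ⟨M ++ L, ?_, by simpa using h.rotate_append⟩
  simpa using List.isRotated_append (l := L) (l' := a :: M)

theorem chain (h : G.IsCyclicList (a :: C)) :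
    ∃ b, G.ChainFromTo a (a :: C) b ∧ G.Adj b a := by
  obtain ⟨-, a', b, h, hba⟩ := h
  obtain rfl : a = a' := by simpa using h.1
  exact ⟨b, h, hba⟩

theorem of_isRotated (h : G.IsCyclicList C) (hr : C ~r L) : G.IsCyclicList L := by
  obtain ⟨n, rfl⟩ := hr
  rw [List.rotate_eq_drop_append_take_mod]
  apply rotate_append
  rwa [List.take_append_drop]

theorem reverse (h : G.IsCyclicList C) : G.IsCyclicList C.reverse := by
  obtain ⟨hn, a, b, h, hba⟩ := h
  exact ⟨List.nodup_reverse.2 hn, b, a, h.reverse, hba.symm⟩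

end IsCyclicList

theorem ChainFromTo.exists_path {α : Type*} {G : SimpleGraph α} {a b : α} {L : List α}
    (h : G.ChainFromTo a L b) (hn : L.Nodup) :
    ∃ p : G.Walk a b, p.IsPath ∧ p.support = L := by
  have hne := h.ne_nil
  have ha : L.head hne = a := by
    have := h.1; rw [List.head?_eq_some_head hne] at this; simpa using this
  have hb : L.getLast hne = b := by
    have := h.2.1; rw [List.getLast?_eq_some_getLast hne] at this; simpa using this
  subst ha hb
  refine ⟨Walk.ofSupport L hne h.2.2, ?_, Walk.support_ofSupport _ _⟩
  rw [Walk.isPath_def, Walk.support_ofSupport]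
  exact hn

/-- A path containing an edge between its two ends consists of that edge. So length at least 3 keeps
the closing edge off the path and excludes the degenerate cycle that `IsCyclicList` admits. -/
theorem IsCyclicList.isHamiltonian {α : Type*} [Fintype α] [DecidableEq α] {G : SimpleGraph α}
    {C : List α} (h : G.IsCyclicList C) (h3 : 3 ≤ C.length) (hC : ∀ v, v ∈ C) :
    G.IsHamiltonian := by
  obtain ⟨hn, a, b, h, hba⟩ := h
  obtain ⟨p, hp, hs⟩ := h.exists_path hn
  intro _
  refine ⟨b, Walk.cons hba p, ?_⟩
  have hlen : p.length + 1 = C.length := by rw [← Walk.length_support, hs]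
  have hcard : C.length = Fintype.card α := by
    rw [← List.toFinset_card_of_nodup hn,
      Finset.eq_univ_of_forall (s := C.toFinset) (by simpa using hC)]
    rfl
  rw [Walk.isHamiltonianCycle_iff_isCycle_and_length_eq]
  refine ⟨?_, by simp [hlen, hcard]⟩
  rw [Walk.cons_isCycle_iff]
  refine ⟨hp, fun he => ?_⟩
  have := hp.length_eq_one_of_mem_edges (by rwa [Sym2.eq_swap])
  omega

end SimpleGraph

/-! ### Hamiltonian cycles of the prism from cycles with hanging paths. -/

namespace SimpleGraph

section Prism

variable {V : Type*} {G : SimpleGraph V}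

theorem prism_adj_of_adj {u v : V} (h : G.Adj u v) (s : Fin 2) :
    G.prism.Adj (u, s) (v, s) := by
  simp [prism, boxProd_adj, h]

theorem prism_adj_level (v : V) (s : Fin 2) : G.prism.Adj (v, s) (v, s + 1) := by
  simp [prism, boxProd_adj]

theorem ChainFromTo.prism {a b : V} {L : List V} (h : G.ChainFromTo a L b) (s : Fin 2) :
    G.prism.ChainFromTo (a, s) (L.map fun v => (v, s)) (b, s) := by
  obtain ⟨h1, h2, h3⟩ := h
  refine ⟨by simp [h1], by simp [h2], ?_⟩
  rw [List.isChain_map]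
  exact h3.imp fun _ _ h => prism_adj_of_adj h s

/-- The walk along `L` at level `s` and back along `L` at the other level. -/
def fold (L : List V) (s : Fin 2) : List (V × Fin 2) :=
  L.map (fun v => (v, s)) ++ L.reverse.map fun v => (v, s + 1)

/-- The concatenation of the folds of the lists `h v`, `v ∈ L`, at alternating levels. -/
def ladder (h : V → List V) : List V → Fin 2 → List (V × Fin 2)
  | [], _ => []
  | v :: L, s => fold (h v) s ++ ladder h L (s + 1)

/-- `h` attaches to each vertex `v` a path starting at `v`. -/
def IsHanging (G : SimpleGraph V) (h : V → List V) : Prop :=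
  ∀ v, (h v).head? = some v ∧ (h v).IsChain G.Adj

theorem IsHanging.fold {h : V → List V} (hh : G.IsHanging h) (v : V) (s : Fin 2) :
    G.prism.ChainFromTo (v, s) (fold (h v) s) (v, s + 1) := by
  obtain ⟨h1, h2⟩ := hh v
  have hne : h v ≠ [] := by rintro h0; simp [h0] at h1
  have hc : G.ChainFromTo v (h v) ((h v).getLast hne) :=
    ⟨h1, List.getLast?_eq_some_getLast hne, h2⟩
  exact (hc.prism s).append (hc.reverse.prism (s + 1)) (prism_adj_level _ _)

/-- Each fold changes the level and each edge of `L` keeps it, so the final level depends on the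
parity of the length only. -/
theorem IsHanging.ladder {h : V → List V} (hh : G.IsHanging h) {a b : V} {L : List V}
    (hL : G.ChainFromTo a L b) (s : Fin 2) :
    G.prism.ChainFromTo (a, s) (ladder h L s) (b, if Even L.length then s else s + 1) := by
  induction L generalizing a s with
  | nil => exact absurd rfl hL.ne_nil
  | cons c L ih =>
    obtain rfl : c = a := by simpa using hL.1
    rcases L with _ | ⟨d, L⟩
    · obtain rfl : c = b := by simpa using hL.2.1
      simpa [SimpleGraph.ladder] using hh.fold c s
    · obtain ⟨hcd, hL'⟩ := hL.tail
      have := (hh.fold c s).append (ih hL' (s + 1)) (prism_adj_of_adj hcd _)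
      have e : s + 1 + 1 = s := by fin_cases s <;> rfl
      rw [e] at this
      have hiff : Even (c :: d :: L).length ↔ ¬ Even (d :: L).length := by
        rw [List.length_cons, Nat.even_add_one]
      by_cases hE : Even (d :: L).length
      · rw [if_neg (fun h => hiff.1 h hE)]; rw [if_pos hE] at this; exact this
      · rw [if_pos (hiff.2 hE)]; rw [if_neg hE] at this; exact this

theorem IsHanging.ladder_even {h : V → List V} (hh : G.IsHanging h) {a b : V} {L : List V}
    (hL : G.ChainFromTo a L b) (hE : Even L.length) (s : Fin 2) :
    G.prism.ChainFromTo (a, s) (SimpleGraph.ladder h L s) (b, s) := by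
  simpa [hE] using hh.ladder hL s

theorem IsHanging.ladder_odd {h : V → List V} (hh : G.IsHanging h) {a b : V} {L : List V}
    (hL : G.ChainFromTo a L b) (hE : Odd L.length) (s : Fin 2) :
    G.prism.ChainFromTo (a, s) (SimpleGraph.ladder h L s) (b, s + 1) := by
  simpa [Nat.not_even_iff_odd.2 hE] using hh.ladder hL s

variable [DecidableEq V]

theorem count_map_level (L : List V) (v : V) (s t : Fin 2) :
    (L.map fun u => (u, s)).count (v, t) = if s = t then L.count v else 0 := by
  split_ifs with h
  · subst h
    exact List.count_map_of_injective L (fun u => (u, s)) (fun _ _ h => (Prod.ext_iff.1 h).1) v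
  · rw [List.count_eq_zero]
    simp only [List.mem_map, not_exists, not_and]
    rintro u - h'
    exact h (Prod.ext_iff.1 h').2

theorem count_fold (L : List V) (v : V) (s t : Fin 2) : (fold L s).count (v, t) = L.count v := by
  rw [fold, List.count_append, count_map_level, count_map_level, List.count_reverse]
  fin_cases s <;> fin_cases t <;> simp

theorem count_ladder (h : V → List V) (L : List V) (v : V) (s t : Fin 2) :
    (ladder h L s).count (v, t) = (L.flatMap h).count v := by
  induction L generalizing s with
  | nil => simp [ladder]
  | cons u L ih => simp [ladder, count_fold, ih]

theorem isPrismHamiltonian_of_count [Fintype V] [Nontrivial V] {a b : V × Fin 2}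
    {W : List (V × Fin 2)} (hW : G.prism.ChainFromTo a W b) (hba : G.prism.Adj b a)
    (hc : ∀ v t, W.count (v, t) = 1) : G.IsPrismHamiltonian := by
  have hmem : ∀ p, p ∈ W := fun p => List.count_pos_iff.1 (by rw [hc p.1 p.2]; exact one_pos)
  have hn : W.Nodup := List.nodup_iff_count_le_one.2 fun p => (hc p.1 p.2).le
  have hC : G.prism.IsCyclicList W := IsCyclicList.mk' hW hba hn
  refine hC.isHamiltonian ?_ hmem
  obtain ⟨u, v, huv⟩ := exists_pair_ne V
  have : ({(u, 0), (u, 1), (v, 0)} : Finset (V × Fin 2)).card ≤ W.toFinset.card :=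
    Finset.card_le_card fun p _ => by simpa using hmem p
  rw [List.toFinset_card_of_nodup hn] at this
  simpa [Finset.card_insert_of_notMem, huv] using this

/-- A list of single pendant vertices attached injectively to the vertices of `B`. -/
theorem exists_isHanging {B : List V} (hB : B.Nodup) {f : V → V}
    (hinj : ∀ u v, u ∉ B → v ∉ B → f u = f v → u = v) (hadj : ∀ v, v ∉ B → G.Adj v (f v))
    (hmem : ∀ v, v ∉ B → f v ∈ B) :
    ∃ h, G.IsHanging h ∧ (∀ u, (∀ v, v ∉ B → f v ≠ u) → h u = [u]) ∧
      ∀ v, (B.flatMap h).count v = 1 := by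
  classical
  -- All `v` outside `B` with `f v = u`: by injectivity there is at most one, so choosing one loses
  -- nothing.
  let pend : V → List V := fun u => if h : ∃ v, v ∉ B ∧ f v = u then [h.choose] else []
  have hp : ∀ u v, v ∈ pend u ↔ v ∉ B ∧ f v = u := by
    intro u v
    simp only [pend]
    split_ifs with h
    · have := h.choose_spec
      rw [List.mem_singleton]
      constructor
      · rintro rfl; exact this
      · rintro ⟨h1, h2⟩
        exact hinj _ _ h1 this.1 (h2.trans this.2.symm)
    · push Not at h
      simpa using h v
  have hlen : ∀ u, (pend u).length ≤ 1 := by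
    intro u; simp only [pend]; split_ifs <;> simp
  refine ⟨fun u => u :: pend u, fun u => ⟨by simp, ?_⟩, ?_, ?_⟩
  · have h1 := hlen u
    have h2 := hp u
    show (u :: pend u).IsChain G.Adj
    generalize pend u = l at h1 h2 ⊢
    rcases l with _ | ⟨w, _ | ⟨w', l⟩⟩
    · simp
    · have := (h2 w).1 (by simp)
      rw [List.isChain_pair, ← this.2]
      exact (hadj w this.1).symm
    · simp at h1
  · intro u hu
    simp only [List.cons.injEq, true_and]
    exact List.eq_nil_iff_forall_not_mem.2 fun v hv => hu v ((hp u v).1 hv).1 ((hp u v).1 hv).2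
  · intro v
    refine List.count_eq_one_of_mem ?_ ?_
    · rw [List.nodup_flatMap]
      constructor
      · intro u hu
        have h1 := hlen u
        have h2 := hp u
        generalize pend u = l at h1 h2
        rcases l with _ | ⟨w, _ | ⟨w', l⟩⟩
        · simp
        · have := (h2 w).1 (by simp)
          simp only [List.nodup_cons, List.mem_singleton, List.not_mem_nil, not_false_eq_true,
            List.nodup_nil, and_true]
          rintro rfl; exact this.1 hu
        · simp at h1
      · refine (List.nodup_iff_pairwise_ne.1 hB).imp_of_mem ?_
        intro a b ha hb hab
        simp only [Function.onFun, List.disjoint_left, List.mem_cons, hp]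
        rintro w (rfl | ⟨h1, h2⟩) (rfl | ⟨h3, h4⟩)
        · exact hab rfl
        · exact h3 ha
        · exact h1 hb
        · exact hab (h2.symm.trans h4)
    · rw [List.mem_flatMap]
      by_cases hv : v ∈ B
      · exact ⟨v, hv, by simp⟩
      · exact ⟨f v, hmem v hv, by simp [hp, hv]⟩

variable [Fintype V] [Nontrivial V]

theorem isPrismHamiltonian_of_even_cycle {C : List V} (hC : G.IsCyclicList C)
    (hE : Even C.length) {h : V → List V} (hh : G.IsHanging h)
    (hc : ∀ v, (C.flatMap h).count v = 1) : G.IsPrismHamiltonian := by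
  obtain ⟨-, a, b, hab, hba⟩ := hC
  refine isPrismHamiltonian_of_count (hh.ladder_even hab hE 0) (prism_adj_of_adj hba 0) ?_
  intro v t
  rw [count_ladder, hc]

/-- An even cycle `C` and a vertex `x` attached to the vertex `c` of `C`. -/
theorem isPrismHamiltonian_of_even_cycle_pendant {C : List V} (hC : G.IsCyclicList C)
    (hE : Even C.length) {x c : V} (hcC : c ∈ C) (hcx : G.Adj c x)
    {h : V → List V} (hh : G.IsHanging h) (hhc : h c = [c])
    (hc : ∀ v, ((x :: C).flatMap h).count v = 1) : G.IsPrismHamiltonian := by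
  classical
  have hn := hC.1
  refine isPrismHamiltonian_of_even_cycle hC hE (h := Function.update h c (c :: h x)) ?_ ?_
  · intro v
    by_cases hv : v = c
    · subst hv
      rw [Function.update_self]
      refine ⟨by simp, ?_⟩
      obtain ⟨h1, h2⟩ := hh x
      rw [List.isChain_cons]
      refine ⟨fun y hy => ?_, h2⟩
      rw [h1] at hy
      obtain rfl := Option.some.inj hy
      exact hcx
    · rw [Function.update_of_ne hv]
      exact hh v
  · obtain ⟨L, M, rfl⟩ := List.append_of_mem hcC
    rw [List.nodup_append] at hn
    have hcM : c ∉ M := (List.nodup_cons.1 hn.2.1).1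
    have hcL : c ∉ L := fun hcL => hn.2.2 c hcL c (by simp) rfl
    have key : ∀ K : List V, c ∉ K →
        K.flatMap (Function.update h c (c :: h x)) = K.flatMap h := by
      intro K hK
      refine List.flatMap_congr ?_
      intro v hv
      rw [Function.update_of_ne]
      rintro rfl; exact hK hv
    intro v
    rw [← hc v]
    simp only [List.flatMap_append, List.flatMap_cons, key L hcL, key M hcM,
      Function.update_self, List.count_append, List.count_cons, hhc, List.count_nil]
    ring

/-- An odd cycle through two vertices `y`, `z` of a triangle `x y z`. -/
theorem isPrismHamiltonian_of_theta {x y z b : V} {P Q : List V}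
    (hC : G.ChainFromTo y (y :: Q ++ z :: P) b) (hby : G.Adj b y)
    (hxy : G.Adj x y) (hxz : G.Adj x z) (hyz : G.Adj y z)
    (hQ : Even Q.length) (hP : Odd P.length)
    {h : V → List V} (hh : G.IsHanging h) (hhy : h y = [y]) (hhz : h z = [z])
    (hc : ∀ v, ((x :: (y :: Q ++ z :: P)).flatMap h).count v = 1) : G.IsPrismHamiltonian := by
  obtain ⟨p, hzp, hPb⟩ : ∃ p, G.Adj z p ∧ G.ChainFromTo p P b := by
    rcases P with _ | ⟨p, P⟩
    · simp at hP
    · exact ⟨p, (ChainFromTo.split (L := y :: Q) (M := P) (c := z) (d := p)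
        (by simpa using hC)).2⟩
  obtain ⟨q, hq, hqz⟩ : ∃ q, G.prism.ChainFromTo (y, 1) ((y, 1) :: ladder h Q 1) (q, 1) ∧
      G.Adj q z := by
    rcases Q with _ | ⟨q, Q⟩
    · exact ⟨y, by simp [ladder, ChainFromTo], hyz⟩
    · obtain ⟨q', hq'⟩ : ∃ q', (q :: Q).getLast? = some q' :=
        ⟨_, List.getLast?_eq_some_getLast (by simp)⟩
      obtain ⟨h1, h2, h3⟩ := hC
      obtain ⟨k1, k2, k3⟩ := List.isChain_append.1 h3
      rw [List.isChain_cons_cons] at k1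
      refine ⟨q', (hh.ladder_even (L := q :: Q) (a := q) ⟨by simp, hq', k1.2⟩ hQ 1).cons
        (prism_adj_of_adj k1.1 1), k3 q' (by simpa using hq') z (by simp)⟩
  have h1 := hh.fold x 1
  have h2 := (hh.ladder_odd hPb hP 0).cons (prism_adj_of_adj hzp 0)
  -- The tour: y and Q at level 1, ending there since Q is even; z at level 1; the fold of x down to
  -- level 0; y and z at level 0; then P, whose odd length leads back to level 1. The copies of y
  -- and of z are visited separately, so nothing may hang there.
  have h3 := hq.append ((h1.append (h2.cons (prism_adj_of_adj hyz 0))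
    (prism_adj_of_adj hxy 0)).cons (prism_adj_of_adj hxz.symm 1)) (prism_adj_of_adj hqz 1)
  refine isPrismHamiltonian_of_count h3 (prism_adj_of_adj hby 1) fun v t => ?_
  refine Eq.trans ?_ (hc v)
  simp only [List.count_append, List.count_cons, count_ladder, List.flatMap_cons, hhy, hhz,
    List.flatMap_append, List.count_nil, count_fold]
  fin_cases t <;> simp [Prod.ext_iff] <;> ring

/-- Two odd cycles meeting in the vertex `y`. -/
theorem isPrismHamiltonian_of_two_odd_cycles {y a b a' b' : V} {A B : List V}
    (hA : G.ChainFromTo a A b) (hB : G.ChainFromTo a' B b')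
    (ha : G.Adj y a) (hb : G.Adj b y) (ha' : G.Adj y a') (hb' : G.Adj b' y)
    (hAo : Odd A.length) (hBo : Odd B.length)
    {h : V → List V} (hh : G.IsHanging h) (hhy : h y = [y])
    (hc : ∀ v, ((y :: (A ++ B)).flatMap h).count v = 1) : G.IsPrismHamiltonian := by
  -- The first odd arc leads from `(y, 0)` to `(y, 1)`, the second one back; y is never folded and
  -- so carries nothing.
  have h1 := (hh.ladder_odd hA hAo 0).cons (prism_adj_of_adj ha 0)
  have h2 := (hh.ladder_odd hB hBo 1).cons (prism_adj_of_adj ha' 1)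
  have h3 := h1.append h2 (prism_adj_of_adj hb 1)
  refine isPrismHamiltonian_of_count h3 (prism_adj_of_adj hb' 0) ?_
  intro v t
  refine Eq.trans ?_ (hc v)
  simp only [List.count_append, List.count_cons, count_ladder, List.flatMap_cons, hhy,
    List.flatMap_append, List.count_nil]
  fin_cases t <;> simp [Prod.ext_iff] <;> ring

end Prism

end SimpleGraph

/-! ### Strict toughness, Hall's theorem, and the cycles that suffice. -/

namespace SimpleGraph

section Toughness

variable {V : Type*} [Fintype V] {G : SimpleGraph V}

/-- Deleting `S` leaves fewer than `|S|` components, as soon as it leaves two. -/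
def IsStrictlyTough (G : SimpleGraph V) : Prop :=
  ∀ S : Finset V, 2 ≤ Nat.card (G.induce {v : V | v ∉ S}).ConnectedComponent →
    Nat.card (G.induce {v : V | v ∉ S}).ConnectedComponent < S.card

theorem IsTough.isStrictlyTough {ε : ℝ} (hε : 0 < ε) (h : G.IsTough (1 + ε)) :
    G.IsStrictlyTough := by
  intro S hS
  have h1 := h _ hS S rfl
  generalize Nat.card (G.induce {v : V | v ∉ S}).ConnectedComponent = p at hS h1
  have h2 : (2 : ℝ) ≤ p := by exact_mod_cast hS
  have h3 : (p : ℝ) < S.card := by nlinarith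
  exact_mod_cast h3

/-- A labelling of `G - S` that is constant along edges uses fewer than `|S|` labels. -/
theorem IsStrictlyTough.card_lt (h : G.IsStrictlyTough) {κ : Type*} [Fintype κ] {S : Finset V}
    (f : V → κ) (hf : ∀ u v, u ∉ S → v ∉ S → G.Adj u v → f u = f v)
    (hs : ∀ k, ∃ v, v ∉ S ∧ f v = k) (hκ : 2 ≤ Fintype.card κ) : Fintype.card κ < S.card := by
  classical
  let H := G.induce {v : V | v ∉ S}
  have hw : ∀ (u v : {v : V | v ∉ S}) (p : H.Walk u v), f u = f v := by
    intro u v p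
    induction p with
    | nil => rfl
    | @cons u v _ hadj _ ih => exact (hf u v u.2 v.2 hadj).trans ih
  let g : H.ConnectedComponent → κ :=
    ConnectedComponent.lift (fun u => f u) (fun u v p _ => hw u v p)
  have hg : Function.Surjective g := by
    intro k
    obtain ⟨v, hv, rfl⟩ := hs k
    exact ⟨H.connectedComponentMk ⟨v, hv⟩, rfl⟩
  have hle : Fintype.card κ ≤ Nat.card H.ConnectedComponent := by
    rw [← Nat.card_eq_fintype_card]
    exact Nat.card_le_card_of_surjective g hg
  exact hle.trans_lt (h S (hκ.trans hle))

open Classical in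
/-- The set of vertices with a neighbour in `T`. -/
noncomputable def nbhd (G : SimpleGraph V) (T : Finset V) : Finset V :=
  Finset.univ.filter fun v => ∃ u ∈ T, G.Adj u v

@[simp] theorem mem_nbhd {T : Finset V} {v : V} : v ∈ G.nbhd T ↔ ∃ u ∈ T, G.Adj u v := by
  simp [nbhd]

/-- Deleting N(T) isolates every vertex of T and leaves a further component containing `w`. -/
theorem IsStrictlyTough.card_add_two_le (h : G.IsStrictlyTough) {T : Finset V}
    (hT : T.Nonempty) (hi : ∀ u ∈ T, ∀ v ∈ T, ¬ G.Adj u v)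
    (hne : ∃ w, w ∉ T ∧ w ∉ G.nbhd T) : T.card + 2 ≤ (G.nbhd T).card := by
  classical
  have hpos := hT.card_pos
  have := h.card_lt (S := G.nbhd T) (κ := Option T)
    (fun v => if hv : v ∈ T then some ⟨v, hv⟩ else none) ?_ ?_ (by simp; omega)
  · simp at this; omega
  · intro u v hu hv huv
    rw [mem_nbhd] at hu hv
    rw [dif_neg fun h => hv ⟨u, h, huv⟩, dif_neg fun h => hu ⟨v, h, huv.symm⟩]
  · rintro (_ | ⟨v, hv⟩)
    · obtain ⟨w, h1, h2⟩ := hne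
      exact ⟨w, h2, by simp [h1]⟩
    · refine ⟨v, ?_, by simp [hv]⟩
      rw [mem_nbhd]
      rintro ⟨u, hu, huv⟩
      exact hi u hu v hv huv

/-- If T ∪ N(T) is everything, the isolated vertices of T alone are the components left by deleting
N(T). This needs |T| ≥ 2; for |T| = 1 the bound comes from |V| ≥ 3. -/
theorem IsStrictlyTough.card_add_one_le (h : G.IsStrictlyTough) (h3 : 3 ≤ Fintype.card V)
    {T : Finset V} (hT : T.Nonempty) (hi : ∀ u ∈ T, ∀ v ∈ T, ¬ G.Adj u v) :
    T.card + 1 ≤ (G.nbhd T).card := by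
  classical
  by_cases hne : ∃ w, w ∉ T ∧ w ∉ G.nbhd T
  · have := h.card_add_two_le hT hi hne
    omega
  push Not at hne
  have hpos := hT.card_pos
  obtain h1 | h1 : T.card = 1 ∨ 2 ≤ T.card := by omega
  · have : Finset.univ ⊆ T ∪ G.nbhd T := by
      intro v _
      by_cases hv : v ∈ T
      · exact Finset.mem_union_left _ hv
      · exact Finset.mem_union_right _ (hne v hv)
    have h2 := (Finset.card_le_card this).trans (Finset.card_union_le _ _)
    rw [Finset.card_univ] at h2
    omega
  · obtain ⟨t, ht⟩ := hT
    have := h.card_lt (S := G.nbhd T) (κ := T)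
      (fun v => if hv : v ∈ T then ⟨v, hv⟩ else ⟨t, ht⟩) ?_ ?_ (by simpa using h1)
    · simp at this; omega
    · intro u v hu hv huv
      rw [mem_nbhd] at hu hv
      rw [dif_neg fun h => hv ⟨u, h, huv⟩, dif_neg fun h => hu ⟨v, h, huv.symm⟩]
    · rintro ⟨v, hv⟩
      refine ⟨v, ?_, by simp [hv]⟩
      rw [mem_nbhd]
      rintro ⟨u, hu, huv⟩
      exact hi u hu v hv huv

theorem IsStrictlyTough.three_le_card (ht : G.IsStrictlyTough) {u w : V} (hwu : w ≠ u)
    (huw : ¬ G.Adj u w) : 3 ≤ (G.nbhd {u}).card := by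
  have := ht.card_add_two_le (T := {u}) (by simp) (by simp)
    ⟨w, by simpa using hwu, by simpa using huw⟩
  simpa using this

/-- Hall's theorem for the independent set of the vertices outside `B`, with a set `D` of
forbidden partners. -/
theorem IsStrictlyTough.exists_matching (h : G.IsStrictlyTough) (h3 : 3 ≤ Fintype.card V)
    {B : List V} (hB : B.Nodup) (hi : ∀ u v, u ∉ B → v ∉ B → ¬ G.Adj u v) (D : Finset V)
    (hD : D.card ≤ 1 ∨ D.card ≤ 2 ∧ Fintype.card V + D.card ≤ 2 * B.length) :
    ∃ f : V → V, (∀ u v, u ∉ B → v ∉ B → f u = f v → u = v) ∧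
      (∀ v, v ∉ B → G.Adj v (f v)) ∧ (∀ v, v ∉ B → f v ∈ B) ∧ ∀ v, v ∉ B → f v ∉ D := by
  classical
  have hall : ∀ T : Finset {v // v ∉ B},
      T.card ≤ (T.biUnion fun v => G.nbhd {v.1} \ D).card := by
    intro T
    rcases T.eq_empty_or_nonempty with rfl | hT
    · simp
    set T' : Finset V := T.map (Function.Embedding.subtype _) with hT'
    have hTc : T'.card = T.card := Finset.card_map _
    have hTB : ∀ v ∈ T', v ∉ B := by
      intro v hv
      obtain ⟨w, -, rfl⟩ := Finset.mem_map.1 hv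
      exact w.2
    have hTn : T'.Nonempty := by simpa [hT'] using hT
    have hTi : ∀ u ∈ T', ∀ v ∈ T', ¬ G.Adj u v := fun u hu v hv => hi u v (hTB u hu) (hTB v hv)
    have e : (T.biUnion fun v => G.nbhd {v.1} \ D) = G.nbhd T' \ D := by
      ext w
      simp only [Finset.mem_biUnion, Finset.mem_sdiff, mem_nbhd, Finset.mem_singleton,
        exists_eq_left, hT', Finset.mem_map, Function.Embedding.subtype_apply]
      constructor
      · rintro ⟨a, ha, h1, h2⟩
        exact ⟨⟨a, ⟨a, ha, rfl⟩, h1⟩, h2⟩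
      · rintro ⟨⟨_, ⟨a, ha, rfl⟩, h1⟩, h2⟩
        exact ⟨a, ha, h1, h2⟩
    rw [e, ← hTc]
    have hsd := Finset.le_card_sdiff D (G.nbhd T')
    have h1 := h.card_add_one_le h3 hTn hTi
    rcases hD with hD | ⟨hD, hD'⟩
    · omega
    by_cases hne : ∃ w, w ∉ T' ∧ w ∉ G.nbhd T'
    · have := h.card_add_two_le hTn hTi hne
      omega
    -- Now N(T') contains `B` and T' lies outside it, so |N(T')| - |D| ≥ |B| - |D| ≥ |V| - |B| ≥
    -- |T'|.
    push Not at hne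
    have h4 : B.toFinset ⊆ G.nbhd T' := by
      intro v hv
      exact hne v fun h' => hTB v h' (by simpa using hv)
    have h5 : T' ⊆ B.toFinsetᶜ := by
      intro v hv
      simpa using hTB v hv
    have h6 := Finset.card_le_card h4
    have h7 := Finset.card_le_card h5
    rw [Finset.card_compl] at h7
    rw [List.toFinset_card_of_nodup hB] at h6 h7
    have h8 : B.length ≤ Fintype.card V := hB.length_le_card
    omega
  obtain ⟨f, hf1, hf2⟩ := (Finset.all_card_le_biUnion_card_iff_exists_injective _).1 hall
  simp only [Finset.mem_sdiff, mem_nbhd, Finset.mem_singleton, exists_eq_left] at hf2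
  refine ⟨fun v => if hv : v ∉ B then f ⟨v, hv⟩ else v, ?_, ?_, ?_, ?_⟩ <;> dsimp only
  · intro u v hu hv huv
    rw [dif_pos hu, dif_pos hv] at huv
    exact congrArg Subtype.val (hf1 huv)
  · intro v hv
    rw [dif_pos hv]
    exact (hf2 ⟨v, hv⟩).1
  · intro v hv
    rw [dif_pos hv]
    by_contra hB'
    exact hi _ _ hv hB' (hf2 ⟨v, hv⟩).1
  · intro v hv
    rw [dif_pos hv]
    exact (hf2 ⟨v, hv⟩).2

variable [DecidableEq V]

theorem IsStrictlyTough.exists_isHanging (h : G.IsStrictlyTough) (h3 : 3 ≤ Fintype.card V)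
    {B : List V} (hB : B.Nodup) (hi : ∀ u v, u ∉ B → v ∉ B → ¬ G.Adj u v) (D : Finset V)
    (hD : D.card ≤ 1 ∨ D.card ≤ 2 ∧ Fintype.card V + D.card ≤ 2 * B.length) :
    ∃ h, G.IsHanging h ∧ (∀ u ∈ D, h u = [u]) ∧ ∀ v, (B.flatMap h).count v = 1 := by
  obtain ⟨f, h1, h2, h4, h5⟩ := h.exists_matching h3 hB hi D hD
  obtain ⟨g, g1, g2, g3⟩ := SimpleGraph.exists_isHanging hB h1 h2 h4
  exact ⟨g, g1, fun u hu => g2 u fun v hv e => h5 v hv (e ▸ hu), g3⟩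

variable {C A B : List V} {x y z a b a' b' c : V}

theorem IsStrictlyTough.isPrismHamiltonian_of_even (h : G.IsStrictlyTough)
    (h3 : 3 ≤ Fintype.card V) (hC : G.IsCyclicList C) (hE : Even C.length)
    (hi : ∀ u v, u ∉ C → v ∉ C → ¬ G.Adj u v) : G.IsPrismHamiltonian := by
  have : Nontrivial V := Fintype.one_lt_card_iff_nontrivial.1 (by omega)
  obtain ⟨g, g1, -, g3⟩ := h.exists_isHanging h3 hC.1 hi ∅ (by simp)
  exact isPrismHamiltonian_of_even_cycle hC hE g1 g3

theorem IsStrictlyTough.isPrismHamiltonian_of_even_pendant (h : G.IsStrictlyTough)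
    (h3 : 3 ≤ Fintype.card V) (hC : G.IsCyclicList C) (hE : Even C.length)
    (hx : x ∉ C) (hcC : c ∈ C) (hcx : G.Adj c x)
    (hi : ∀ u v, u ∉ x :: C → v ∉ x :: C → ¬ G.Adj u v) : G.IsPrismHamiltonian := by
  have : Nontrivial V := Fintype.one_lt_card_iff_nontrivial.1 (by omega)
  obtain ⟨g, g1, g2, g3⟩ := h.exists_isHanging h3 (List.nodup_cons.2 ⟨hx, hC.1⟩) hi {c} (by simp)
  exact isPrismHamiltonian_of_even_cycle_pendant hC hE hcC hcx g1 (g2 c (by simp)) g3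

/-- The matching must avoid both y and z, and `hcard` is the bound for two forbidden partners, as
the matching goes into the |C| + 1 vertices of `x :: C`. The two arcs of C between y and z have
different parities; exchanging y and z puts the even one first. -/
theorem IsStrictlyTough.isPrismHamiltonian_of_odd_triangle (h : G.IsStrictlyTough)
    (h3 : 3 ≤ Fintype.card V) (hC : G.IsCyclicList C) (hO : Odd C.length)
    (hx : x ∉ C) (hy : y ∈ C) (hz : z ∈ C) (hxy : G.Adj x y) (hxz : G.Adj x z) (hyz : G.Adj y z)
    (hi : ∀ u v, u ∉ x :: C → v ∉ x :: C → ¬ G.Adj u v)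
    (hcard : Fintype.card V ≤ 2 * C.length) : G.IsPrismHamiltonian := by
  have : Nontrivial V := Fintype.one_lt_card_iff_nontrivial.1 (by omega)
  obtain ⟨g, g1, g2, g3⟩ := h.exists_isHanging h3 (List.nodup_cons.2 ⟨hx, hC.1⟩) hi {y, z}
    (Or.inr ⟨Finset.card_le_two, by
      have := Finset.card_le_two (a := y) (b := z)
      simp only [List.length_cons]; omega⟩)
  have hgy := g2 y (by simp)
  have hgz := g2 z (by simp)
  obtain ⟨C', hr, hC'⟩ := hC.exists_rotation_first hy
  have hz' : z ∈ C' := by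
    have := hr.mem_iff.1 hz
    simpa [hyz.ne'] using this
  obtain ⟨Q, P, rfl⟩ := List.append_of_mem hz'
  have hc : ∀ D, C ~r D → ∀ v, ((x :: D).flatMap g).count v = 1 := by
    intro D hD v
    rw [← g3 v]
    exact ((hD.perm.cons x).flatMap_right g).symm.count_eq v
  have hO' := hr.perm.length_eq ▸ hO
  have hlen : Odd (Q.length + P.length) := by
    simp only [List.length_cons, List.length_append] at hO'
    rw [show Q.length + (P.length + 1) + 1 = Q.length + P.length + 2 by ring] at hO'
    simpa [parity_simps] using hO'
  rcases Nat.even_or_odd Q.length with hQ | hQ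
  · obtain ⟨b, hb, hby⟩ := hC'.chain
    exact isPrismHamiltonian_of_theta hb hby hxy hxz hyz hQ (by simpa [Nat.odd_add', hQ] using hlen)
      g1 hgy hgz (hc _ hr)
  · have hC2 : G.IsCyclicList (z :: P ++ y :: Q) := by
      apply IsCyclicList.rotate_append; simpa using hC'
    have hr2 : C ~r z :: P ++ y :: Q := by
      refine hr.trans ?_
      simpa using List.isRotated_append (l := y :: Q) (l' := z :: P)
    obtain ⟨b, hb, hby⟩ := hC2.chain
    exact isPrismHamiltonian_of_theta hb hby hxz hxy hyz.symm
      (by simpa [Nat.odd_add, hQ] using hlen) hQ g1 hgz hgy (hc _ hr2)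

theorem IsStrictlyTough.isPrismHamiltonian_of_two_odd (h : G.IsStrictlyTough)
    (h3 : 3 ≤ Fintype.card V) (hA : G.ChainFromTo a A b) (hB : G.ChainFromTo a' B b')
    (ha : G.Adj y a) (hb : G.Adj b y) (ha' : G.Adj y a') (hb' : G.Adj b' y)
    (hAo : Odd A.length) (hBo : Odd B.length) (hn : (y :: (A ++ B)).Nodup)
    (hi : ∀ u v, u ∉ y :: (A ++ B) → v ∉ y :: (A ++ B) → ¬ G.Adj u v) :
    G.IsPrismHamiltonian := by
  have : Nontrivial V := Fintype.one_lt_card_iff_nontrivial.1 (by omega)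
  obtain ⟨g, g1, g2, g3⟩ := h.exists_isHanging h3 hn hi {y} (by simp)
  exact isPrismHamiltonian_of_two_odd_cycles hA hB ha hb ha' hb' hAo hBo g1 (g2 y (by simp)) g3

end Toughness

end SimpleGraph

/-! ### A triangle from toughness and 5-chordality. -/

namespace SimpleGraph

section Triangle

variable {V : Type*} {G : SimpleGraph V}

/-- A repeated vertex splits the closed walk into two closed walks. One of them is odd and shorter.
-/
theorem isPath_of_shortest_odd {u v : V} {h : G.Adj v u} {p : G.Walk u v} (hp : Even p.length)
    (hmin : ∀ (w : V) (d : G.Walk w w), Odd d.length → p.length + 1 ≤ d.length) : p.IsPath := by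
  rw [← Walk.IsPath.getVert_injOn_iff]
  suffices key : ∀ i j, i < j → j ≤ p.length → p.getVert i ≠ p.getVert j by
    intro i hi j hj hij
    simp only [Set.mem_ofPred_eq] at hi hj
    by_contra hne
    rcases lt_or_gt_of_ne hne with h | h
    · exact key i j h hj hij
    · exact key j i h hi hij.symm
  intro i j hlt hj hij
  have hi : i ≤ p.length := by omega
  have h1 : ((p.drop i).take (j - i)).length = j - i := by
    simp [Walk.take_length, Walk.drop_length]; omega
  have h2 : (p.drop i).getVert (j - i) = p.getVert i := by
    rw [Walk.drop_getVert, hij]; congr 1; omega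
  rcases Nat.even_or_odd (j - i) with he | ho
  · have := hmin v (Walk.cons h ((p.take i).append ((p.drop j).copy hij.symm rfl))) (by
      simp only [Walk.length_cons, Walk.length_append, Walk.length_copy, Walk.take_length,
        Walk.drop_length, min_eq_left hi]
      obtain ⟨a, ha⟩ := hp; obtain ⟨b, hb⟩ := he
      exact ⟨a - b, by omega⟩)
    simp only [Walk.length_cons, Walk.length_append, Walk.length_copy, Walk.take_length,
        Walk.drop_length, min_eq_left hi] at this
    omega
  · have := hmin _ (((p.drop i).take (j - i)).copy rfl h2) (by simpa [h1] using ho)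
    simp [h1] at this
    omega

theorem mem_edges_of_length_one {u v : V} {p : G.Walk u v} (h : p.length = 1) :
    s(u, v) ∈ p.edges := by
  match p, h with
  | .cons _ .nil, _ => simp

/-- A shortest odd closed walk is a cycle. A chord would close up both of its arcs, each of length
at least 2, and the even arc would give a shorter odd closed walk. So the length is odd and below 5.
-/
theorem exists_triangle_of_not_colorable (hG : ¬ G.Colorable 2) (h5 : G.IsKChordal 5) :
    ∃ x y z, G.Adj x y ∧ G.Adj y z ∧ G.Adj x z := by
  classical
  rw [two_colorable_iff_forall_loop_even] at hG
  push Not at hG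
  obtain ⟨v, c, hc, hmin⟩ : ∃ (v : V) (c : G.Walk v v), Odd c.length ∧
      ∀ (w : V) (d : G.Walk w w), Odd d.length → c.length ≤ d.length := by
    have hex : ∃ n, ∃ (v : V) (c : G.Walk v v), Odd c.length ∧ c.length = n := by
      obtain ⟨v, c, hc⟩ := hG
      exact ⟨_, v, c, Nat.not_even_iff_odd.1 hc, rfl⟩
    obtain ⟨v, c, hc, hn⟩ := Nat.find_spec hex
    exact ⟨v, c, hc, fun w d hd => hn ▸ Nat.find_min' hex ⟨w, d, hd, rfl⟩⟩
  have hcyc : c.IsCycle := by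
    cases c with
    | nil => simp at hc
    | cons h p =>
      rw [Walk.length_cons] at hc hmin
      have hp : p.IsPath := isPath_of_shortest_odd (h := h) (by simpa [parity_simps] using hc) hmin
      rw [Walk.cons_isCycle_iff]
      refine ⟨hp, fun he => ?_⟩
      have := hp.length_eq_one_of_mem_edges (by rwa [Sym2.eq_swap])
      rw [this] at hc
      exact absurd hc (by decide)
  have hlt : c.length < 5 := by
    by_contra hge
    obtain ⟨e, he⟩ := h5 v c hcyc (by omega)
    induction e with | _ u w
    rw [Walk.isChord_sym2Mk] at he
    obtain ⟨huw, hne, hu, hw⟩ := he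
    have hw' : w ∈ (c.rotate u hu).support := by simpa using hw
    set p := (c.rotate u hu).takeUntil w hw' with hp
    set q := (c.rotate u hu).dropUntil w hw' with hq
    have hpq : p.append q = c.rotate u hu := Walk.take_spec _ _
    have hlen : p.length + q.length = c.length := by
      rw [← Walk.length_append, hpq, Walk.length_rotate]
    have hedge : ∀ e, e ∈ c.edges ↔ e ∈ p.edges ∨ e ∈ q.edges := by
      intro e
      rw [← List.mem_append, ← Walk.edges_append, hpq]
      exact (c.rotate_edges u hu).symm.mem_iff
    have hp2 : p.length ≠ 1 := fun h => hne ((hedge _).2 (Or.inl (mem_edges_of_length_one h)))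
    have hq2 : q.length ≠ 1 := fun h => hne ((hedge _).2 (Or.inr (by
      rw [Sym2.eq_swap]; exact mem_edges_of_length_one h)))
    have hp0 : p.length ≠ 0 := fun h => huw.ne (Walk.eq_of_length_eq_zero h)
    have hq0 : q.length ≠ 0 := fun h => huw.ne (Walk.eq_of_length_eq_zero h).symm
    have k1 := hmin _ (Walk.cons huw.symm p)
    have k2 := hmin _ (Walk.cons huw q)
    simp only [Walk.length_cons, Nat.odd_iff] at k1 k2 hc
    omega
  have hge := hcyc.three_le_length
  match c, hc, hlt, hge with
  | .cons h1 (.cons h2 (.cons h3 .nil)), _, _, _ => exact ⟨_, _, _, h1, h2, h3.symm⟩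
  | .cons h1 (.cons h2 (.cons h3 (.cons h4 .nil))), hc, _, _ => exact absurd hc (by simp; decide)
  | .cons _ .nil, _, _, h => simp at h
  | .cons _ (.cons _ .nil), _, _, h => simp at h
  | .cons h1 (.cons h2 (.cons h3 (.cons h4 (.cons h5 _)))), _, h, _ => simp at h; omega

/-- Each colour class would have its neighbourhood inside the other class and so be strictly smaller
than it. -/
theorem IsStrictlyTough.not_colorable_two [Fintype V] (h : G.IsStrictlyTough)
    (h3 : 3 ≤ Fintype.card V) : ¬ G.Colorable 2 := by
  classical
  rintro ⟨C⟩
  let I : Fin 2 → Finset V := fun i => Finset.univ.filter fun v => C v = i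
  have hi : ∀ i, ∀ u ∈ I i, ∀ v ∈ I i, ¬ G.Adj u v := by
    intro i u hu v hv huv
    simp only [I, Finset.mem_filter, Finset.mem_univ, true_and] at hu hv
    exact C.valid huv (hu.trans hv.symm)
  have hN : ∀ i, G.nbhd (I i) ⊆ I (i + 1) := by
    intro i v hv
    rw [mem_nbhd] at hv
    obtain ⟨u, hu, huv⟩ := hv
    have := C.valid huv
    simp only [I, Finset.mem_filter, Finset.mem_univ, true_and] at hu ⊢
    subst hu
    generalize C u = a at this
    generalize C v = b at this
    revert a b; decide
  have hle : ∀ i, (I i).Nonempty → (I i).card + 1 ≤ (I (i + 1)).card := fun i hI =>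
    (h.card_add_one_le h3 hI (hi i)).trans (Finset.card_le_card (hN i))
  obtain ⟨v⟩ : Nonempty V := Fintype.card_pos_iff.1 (by omega)
  have hv : (I (C v)).Nonempty := ⟨v, by simp [I]⟩
  have h1 := hle _ hv
  have h2 := hle (C v + 1) (Finset.card_pos.1 (by omega))
  have e : C v + 1 + 1 = C v := by
    generalize C v = a; revert a; decide
  rw [e] at h2
  omega

end Triangle

end SimpleGraph

/-! ### The crossing argument for two disjoint paths. -/

namespace SimpleGraph

section Crossing

variable {V : Type*} {G : SimpleGraph V}

/-- The cycle runs from a through P to b, back along S to s, over to t, and along T to a. -/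
theorem ChainFromTo.isCyclicList_join {P S T : List V} {p q s t a b : V}
    (hP : G.ChainFromTo p P q) (hS : G.ChainFromTo s S b) (hT : G.ChainFromTo t T a)
    (hap : G.Adj a p) (hqb : G.Adj q b) (hst : G.Adj s t) (hn : (P ++ (S ++ T)).Nodup) :
    G.IsCyclicList (P ++ (S.reverse ++ T)) := by
  refine IsCyclicList.mk' (hP.append (hS.reverse.append hT hst) hqb) hap ?_
  refine (List.Perm.nodup_iff ?_).1 hn
  exact ((List.reverse_perm S).symm.append_right T).append_left P

/-- Two disjoint paths `e₁ e₂ … b` and `c₁ c₂ … a`, such that the starts of two disjoint paths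
ending in `b` and in `a` and covering all vertices of the given paths but possibly `e₁` and `c₁`
are never adjacent. The new vertices of these paths have to satisfy `ok`. -/
structure IsUnjoinable (G : SimpleGraph V) (ok : V → Prop) (a b e₁ e₂ : V) (R : List V)
    (c₁ c₂ : V) (Q : List V) : Prop where
  chain_left : G.ChainFromTo e₁ (e₁ :: e₂ :: R) b
  chain_right : G.ChainFromTo c₁ (c₁ :: c₂ :: Q) a
  nodup : (e₁ :: e₂ :: R ++ c₁ :: c₂ :: Q).Nodup
  ok_of_mem : ∀ v ∈ e₁ :: e₂ :: R ++ c₁ :: c₂ :: Q, ok v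
  not_adj : ∀ s S t T, G.ChainFromTo s S b → G.ChainFromTo t T a → (S ++ T).Nodup →
    (∀ v ∈ S ++ T, ok v) → (∀ v ∈ e₂ :: R, v ∈ S ++ T) → (∀ v ∈ c₂ :: Q, v ∈ S ++ T) →
    ¬ G.Adj s t

namespace IsUnjoinable

variable {ok : V → Prop} {a b e₁ e₂ c₁ c₂ : V} {R Q : List V}

theorem symm (h : G.IsUnjoinable ok a b e₁ e₂ R c₁ c₂ Q) :
    G.IsUnjoinable ok b a c₁ c₂ Q e₁ e₂ R where
  chain_left := h.chain_right
  chain_right := h.chain_left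
  nodup := List.nodup_append_comm.1 h.nodup
  ok_of_mem v hv := h.ok_of_mem v (by rw [List.mem_append] at hv ⊢; exact hv.symm)
  not_adj s S t T hS hT hn hok h1 h2 hst := by
    have hp : (T ++ S).Perm (S ++ T) := List.perm_append_comm
    exact h.not_adj t T s S hT hS (hp.nodup_iff.2 hn) (fun v hv => hok v (hp.mem_iff.1 hv))
      (fun v hv => hp.mem_iff.2 (h2 v hv)) (fun v hv => hp.mem_iff.2 (h1 v hv)) hst.symm

/-- Since `not_adj` allows the first vertex to be dropped, either end of the edge e₁e₂ can serve as
the start of a path to b. -/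
theorem exists_suffix (h : G.IsUnjoinable ok a b e₁ e₂ R c₁ c₂ Q) {u : V}
    (hu : u = e₁ ∨ u = e₂) : ∃ K, G.ChainFromTo u (u :: K ++ R) b ∧
      (u :: K ++ R).Sublist (e₁ :: e₂ :: R) ∧ ∀ v ∈ e₂ :: R, v ∈ u :: K ++ R := by
  rcases hu with rfl | rfl
  · exact ⟨[e₂], by simpa using h.chain_left, by simp,
      fun v hv => List.mem_cons_of_mem _ (by simpa using hv)⟩
  · exact ⟨[], by simpa using h.chain_left.tail.2, by simp, by simp⟩

theorem not_adj_of_left_right (h : G.IsUnjoinable ok a b e₁ e₂ R c₁ c₂ Q) {u w : V}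
    (hu : u = e₁ ∨ u = e₂) (hw : w = c₁ ∨ w = c₂) : ¬ G.Adj u w := by
  obtain ⟨K, hS, hSs, hS2⟩ := h.exists_suffix hu
  obtain ⟨M, hT, hTs, hT2⟩ := h.symm.exists_suffix hw
  have hs := hSs.append hTs
  exact h.not_adj u _ w _ hS hT (h.nodup.sublist hs) (fun v hv => h.ok_of_mem v (hs.subset hv))
    (fun v hv => List.mem_append_left _ (hS2 v hv))
    (fun v hv => List.mem_append_right _ (hT2 v hv))

/-- Otherwise `v`, put in front of the right path, becomes a start adjacent to `u`. -/
theorem not_common (h : G.IsUnjoinable ok a b e₁ e₂ R c₁ c₂ Q) {v u w : V} (hv : ok v)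
    (hvn : v ∉ e₁ :: e₂ :: R ++ c₁ :: c₂ :: Q)
    (hu : u = e₁ ∨ u = e₂) (hw : w = c₁ ∨ w = c₂) : ¬ (G.Adj u v ∧ G.Adj w v) := by
  rintro ⟨huv, hwv⟩
  obtain ⟨K, hS, hSs, hS2⟩ := h.exists_suffix hu
  obtain ⟨M, hT, hTs, hT2⟩ := h.symm.exists_suffix hw
  have hs := hSs.append hTs
  have hp : ((u :: K ++ R) ++ v :: (w :: M ++ Q)).Perm (v :: ((u :: K ++ R) ++ (w :: M ++ Q))) :=
    List.perm_middle
  refine h.not_adj u _ v _ hS (hT.cons hwv.symm) ?_ ?_ ?_ ?_ huv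
  · rw [hp.nodup_iff, List.nodup_cons]
    exact ⟨fun hv' => hvn (hs.subset hv'), h.nodup.sublist hs⟩
  · intro y hy
    rw [hp.mem_iff, List.mem_cons] at hy
    rcases hy with rfl | hy
    · exact hv
    · exact h.ok_of_mem y (hs.subset hy)
  · exact fun y hy => List.mem_append_left _ (hS2 y hy)
  · exact fun y hy => List.mem_append_right _ (List.mem_cons_of_mem _ (hT2 y hy))

/-- For consecutive l, l' with l adjacent to the right edge and l' to the left one, reverse the part
of the left path up to l and jump to l'. The new path still ends in b, but starts in l, next to a
start of the right path. -/
theorem isChain_left (h : G.IsUnjoinable ok a b e₁ e₂ R c₁ c₂ Q) :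
    R.IsChain fun l l' => ¬ ((G.Adj c₁ l ∨ G.Adj c₂ l) ∧ (G.Adj e₁ l' ∨ G.Adj e₂ l')) := by
  rw [List.isChain_iff_forall_rel_of_append_cons_cons]
  rintro l l' K K' rfl ⟨hl, hl'⟩
  obtain ⟨w, hw, hwl⟩ : ∃ w, (w = c₁ ∨ w = c₂) ∧ G.Adj w l := by
    rcases hl with hl | hl
    exacts [⟨_, Or.inl rfl, hl⟩, ⟨_, Or.inr rfl, hl⟩]
  obtain ⟨u, hu, hul⟩ : ∃ u, (u = e₁ ∨ u = e₂) ∧ G.Adj u l' := by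
    rcases hl' with hl' | hl'
    exacts [⟨_, Or.inl rfl, hl'⟩, ⟨_, Or.inr rfl, hl'⟩]
  obtain ⟨L, hS, hSs, hS2⟩ := h.exists_suffix hu
  obtain ⟨M, hT, hTs, hT2⟩ := h.symm.exists_suffix hw
  rw [← List.append_assoc] at hS hSs hS2
  obtain ⟨h1, -, h2⟩ := hS.split
  have hs := hSs.append hTs
  have hp : (((u :: L ++ K ++ [l]).reverse ++ l' :: K') ++ (w :: M ++ Q)).Perm
      ((u :: L ++ K ++ l :: l' :: K') ++ (w :: M ++ Q)) := by
    refine List.Perm.append_right _ ?_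
    have := (List.reverse_perm (u :: L ++ K ++ [l])).append_right (l' :: K')
    simpa using this
  refine h.not_adj l _ w _ (h1.reverse.append h2 hul) hT ?_ ?_ ?_ ?_ hwl.symm
  · rw [hp.nodup_iff]; exact h.nodup.sublist hs
  · intro y hy
    exact h.ok_of_mem y (hs.subset (hp.mem_iff.1 hy))
  · exact fun y hy => hp.mem_iff.2 (List.mem_append_left _ (hS2 y hy))
  · exact fun y hy => List.mem_append_right _ (hT2 y hy)

end IsUnjoinable

/-- Shifted by one place, the positions satisfying B avoid those satisfying A, and all lie among |L|
+ 1 places. The induction uses that the first place is filled only if the head satisfies A. -/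
theorem countP_add_countP_le {α : Type*} (A B : α → Bool) (L : List α)
    (h : L.IsChain fun l l' => ¬ (B l ∧ A l')) : L.countP A + L.countP B ≤ L.length + 1 := by
  suffices L.countP A + L.countP B ≤ L.length + if L.head?.any A then 1 else 0 by
    split_ifs at this <;> omega
  induction L with
  | nil => simp
  | cons l L ih =>
    rcases L with _ | ⟨l', L⟩
    · cases hA : A l <;> cases hB : B l <;> simp [hA, hB]
    · rw [List.isChain_cons_cons] at h
      have h1 := ih h.2
      have h2 := h.1
      rw [List.countP_cons, List.countP_cons (l := l' :: L)]
      simp only [List.head?_cons, Option.any_some, List.length_cons] at h1 ⊢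
      by_cases hA : A l = true <;> by_cases hB : B l = true <;> by_cases hA' : A l' = true <;>
        simp only [hA, hB, hA', and_self, not_true_eq_false, if_false, if_true,
          Bool.false_eq_true] at h1 h2 ⊢ <;> omega

variable [Fintype V]

open Classical in
/-- The neighbours of the edge `uv`. -/
noncomputable def edgeNbhd (G : SimpleGraph V) (u v : V) : Finset V :=
  Finset.univ.filter fun w => (G.Adj u w ∨ G.Adj v w) ∧ w ≠ u ∧ w ≠ v

theorem mem_edgeNbhd {u v w : V} :
    w ∈ G.edgeNbhd u v ↔ (G.Adj u w ∨ G.Adj v w) ∧ w ≠ u ∧ w ≠ v := by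
  simp [edgeNbhd]

theorem edgeDegree_eq_card {u v : V} : G.edgeDegree s(u, v) = (G.edgeNbhd u v).card := by
  rw [edgeDegree, ← Set.ncard_coe_finset]
  congr 1
  ext w
  simp [mem_edgeNbhd]

theorem edgeNbhd_comm {u v : V} : G.edgeNbhd u v = G.edgeNbhd v u := by
  ext w
  simp only [mem_edgeNbhd]
  tauto

variable [DecidableEq V]

/-- Neither e₁ nor e₂ is counted in either set, so everything happens on R, where `isChain_left`
allows a total of |R| + 1. -/
theorem IsUnjoinable.card_inter_add_card_inter_le {ok : V → Prop} {a b e₁ e₂ c₁ c₂ : V}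
    {R Q : List V} (h : G.IsUnjoinable ok a b e₁ e₂ R c₁ c₂ Q) :
    (G.edgeNbhd e₁ e₂ ∩ (e₁ :: e₂ :: R).toFinset).card +
      (G.edgeNbhd c₁ c₂ ∩ (e₁ :: e₂ :: R).toFinset).card + 1 ≤ (e₁ :: e₂ :: R).length := by
  classical
  have hR : R.Nodup := by
    have := (List.nodup_append.1 h.nodup).1
    simp only [List.nodup_cons] at this
    exact this.2.2
  have key : ∀ A : V → Bool, (R.toFinset.filter fun v => A v).card = R.countP A := by
    intro A
    rw [← List.toFinset_filter, List.toFinset_card_of_nodup (hR.filter _),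
      List.countP_eq_length_filter]
  have h1 : (G.edgeNbhd e₁ e₂ ∩ (e₁ :: e₂ :: R).toFinset).card ≤
      R.countP fun v => decide (G.Adj e₁ v ∨ G.Adj e₂ v) := by
    rw [← key]
    refine Finset.card_le_card fun v hv => ?_
    simp only [Finset.mem_inter, mem_edgeNbhd, List.mem_toFinset, List.mem_cons, ne_eq] at hv
    simp only [Finset.mem_filter, List.mem_toFinset, decide_eq_true_eq]
    tauto
  have h2 : (G.edgeNbhd c₁ c₂ ∩ (e₁ :: e₂ :: R).toFinset).card ≤
      R.countP fun v => decide (G.Adj c₁ v ∨ G.Adj c₂ v) := by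
    rw [← key]
    refine Finset.card_le_card fun v hv => ?_
    simp only [Finset.mem_inter, mem_edgeNbhd, List.mem_toFinset, List.mem_cons, ne_eq] at hv
    simp only [Finset.mem_filter, List.mem_toFinset, decide_eq_true_eq]
    obtain ⟨⟨hv, -⟩, rfl | rfl | hv'⟩ := hv
    · exact absurd (hv.imp G.adj_symm G.adj_symm) (by
        rintro (hv | hv)
        · exact h.not_adj_of_left_right (Or.inl rfl) (Or.inl rfl) hv
        · exact h.not_adj_of_left_right (Or.inl rfl) (Or.inr rfl) hv)
    · exact absurd (hv.imp G.adj_symm G.adj_symm) (by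
        rintro (hv | hv)
        · exact h.not_adj_of_left_right (Or.inr rfl) (Or.inl rfl) hv
        · exact h.not_adj_of_left_right (Or.inr rfl) (Or.inr rfl) hv)
    · exact ⟨hv', hv⟩
  have h3 := countP_add_countP_le (fun v => decide (G.Adj e₁ v ∨ G.Adj e₂ v))
    (fun v => decide (G.Adj c₁ v ∨ G.Adj c₂ v)) R (by simpa using h.isChain_left)
  simp only [List.length_cons]
  omega

/-- Each path contributes at most its length minus one, and a vertex of W, off both paths, at most
one by `not_common`; H contributes nothing. The 3 consists of x and the two losses on the paths. -/
theorem IsUnjoinable.card_add_card_le {ok : V → Prop} {a b e₁ e₂ c₁ c₂ x : V}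
    {R Q : List V} (h : G.IsUnjoinable ok a b e₁ e₂ R c₁ c₂ Q)
    (hxn : x ∉ e₁ :: e₂ :: R ++ c₁ :: c₂ :: Q) {H : Finset V}
    (hok : ∀ v, v ≠ x → v ∉ H → ok v) (hxH : x ∉ H)
    (hHn : ∀ v ∈ H, v ∉ e₁ :: e₂ :: R ++ c₁ :: c₂ :: Q)
    (hH₁ : ∀ v ∈ H, v ∉ G.edgeNbhd e₁ e₂) (hH₂ : ∀ v ∈ H, v ∉ G.edgeNbhd c₁ c₂) :
    (G.edgeNbhd e₁ e₂ \ {x}).card + (G.edgeNbhd c₁ c₂ \ {x}).card + H.card + 3 ≤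
      Fintype.card V := by
  set Z₁ := (e₁ :: e₂ :: R).toFinset with hZ₁
  set Z₂ := (c₁ :: c₂ :: Q).toFinset with hZ₂
  set W := (Z₁ ∪ Z₂ ∪ H ∪ {x})ᶜ with hW
  have hn := List.nodup_append.1 h.nodup
  have hWc : Z₁.card + Z₂.card + H.card + 1 + W.card = Fintype.card V := by
    have d1 : Disjoint Z₁ Z₂ := by
      rw [Finset.disjoint_left]
      exact fun v h1 h2 => hn.2.2 v (List.mem_toFinset.1 h1) v (List.mem_toFinset.1 h2) rfl
    have d2 : Disjoint (Z₁ ∪ Z₂) H := by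
      rw [Finset.disjoint_right]
      intro v hv
      have := hHn v hv
      rw [List.mem_append] at this
      rwa [Finset.mem_union, List.mem_toFinset, List.mem_toFinset]
    have d3 : Disjoint (Z₁ ∪ Z₂ ∪ H) {x} := by
      rw [Finset.disjoint_singleton_right]
      rw [List.mem_append] at hxn
      rw [Finset.mem_union, Finset.mem_union, List.mem_toFinset, List.mem_toFinset]
      tauto
    rw [← Finset.card_add_card_compl (Z₁ ∪ Z₂ ∪ H ∪ {x}), Finset.card_union_of_disjoint d3,
      Finset.card_union_of_disjoint d2, Finset.card_union_of_disjoint d1, Finset.card_singleton]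
  have hc1 : Z₁.card = (e₁ :: e₂ :: R).length := List.toFinset_card_of_nodup hn.1
  have hc2 : Z₂.card = (c₁ :: c₂ :: Q).length := List.toFinset_card_of_nodup hn.2.1
  have key : ∀ N : Finset V, (∀ v ∈ H, v ∉ N) →
      (N \ {x}).card ≤ (N ∩ Z₁).card + (N ∩ Z₂).card + (N ∩ W).card := by
    intro N hN
    refine le_trans (Finset.card_le_card ?_) ((Finset.card_union_le _ _).trans
      (Nat.add_le_add_right (Finset.card_union_le _ _) _))
    intro v hv
    simp only [Finset.mem_sdiff, Finset.mem_singleton, Finset.mem_union, Finset.mem_inter, hW,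
      Finset.mem_compl] at hv ⊢
    have := hN v
    tauto
  have k1 := key _ hH₁
  have k2 := key _ hH₂
  have k3 := h.card_inter_add_card_inter_le
  have k4 := h.symm.card_inter_add_card_inter_le
  rw [← hZ₁, ← hc1] at k3
  rw [← hZ₂, ← hc2] at k4
  have k5 : (G.edgeNbhd e₁ e₂ ∩ W).card + (G.edgeNbhd c₁ c₂ ∩ W).card ≤ W.card := by
    rw [← Finset.card_union_of_disjoint]
    · refine Finset.card_le_card (Finset.union_subset ?_ ?_) <;> exact Finset.inter_subset_right
    · rw [Finset.disjoint_left]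
      intro v hv hv'
      simp only [Finset.mem_inter, mem_edgeNbhd, hW, Finset.mem_compl, Finset.mem_union, not_or,
        Finset.mem_singleton, hZ₁, hZ₂, List.mem_toFinset] at hv hv'
      have hvok := hok v hv.2.2 hv.2.1.2
      have hvn : v ∉ e₁ :: e₂ :: R ++ c₁ :: c₂ :: Q := by
        rw [List.mem_append]; tauto
      rcases hv.1.1 with h1 | h1 <;> rcases hv'.1.1 with h2 | h2
      · exact h.not_common hvok hvn (Or.inl rfl) (Or.inl rfl) ⟨h1, h2⟩
      · exact h.not_common hvok hvn (Or.inl rfl) (Or.inr rfl) ⟨h1, h2⟩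
      · exact h.not_common hvok hvn (Or.inr rfl) (Or.inl rfl) ⟨h1, h2⟩
      · exact h.not_common hvok hvn (Or.inr rfl) (Or.inr rfl) ⟨h1, h2⟩
  omega

end Crossing

end SimpleGraph

/-! ### Rerouting a cycle through an outside path. -/

namespace SimpleGraph

section Reroute

variable {V : Type*} [DecidableEq V] {G : SimpleGraph V}

/-- `C'` is a cycle avoiding `x` that misses only vertices of the cycle `C` which are pairwise
nonadjacent and have no neighbours outside `C` and `x`. -/
def IsReroute (G : SimpleGraph V) (x : V) (C C' : List V) : Prop :=
  G.IsCyclicList C' ∧ x ∉ C' ∧ (∀ v ∈ C, v ∉ C' → ∀ w, w ∉ C → w ≠ x → ¬ G.Adj v w) ∧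
    ∀ u ∈ C, ∀ v ∈ C, u ∉ C' → v ∉ C' → ¬ G.Adj u v

/-- `s` is a neighbour of `f` outside `C` and `x` or, failing that, the successor of `f` on `C`. -/
def IsPartner (G : SimpleGraph V) (x : V) (C : List V) (f s : V) : Prop :=
  (s ∉ C ∧ s ≠ x ∧ G.Adj f s) ∨
    (s = C.formPerm f ∧ ∀ w, w ∉ C → w ≠ x → ¬ G.Adj f w)

variable {C : List V} {a b x : V}

theorem exists_isPartner (x : V) (C : List V) (f : V) : ∃ s, G.IsPartner x C f s := by
  by_cases h : ∃ w, w ∉ C ∧ w ≠ x ∧ G.Adj f w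
  · exact h.imp fun w hw => Or.inl hw
  · push Not at h
    exact ⟨_, Or.inr ⟨rfl, h⟩⟩

/-- The cycle `C`, cut into the path from the successor of `a` to `b` and that from the successor
of `b` to `a`. -/
theorem IsCyclicList.exists_split (hC : G.IsCyclicList C) (ha : a ∈ C) (hb : b ∈ C) (hab : a ≠ b) :
    ∃ L M, C ~r L ++ M ∧ G.ChainFromTo (C.formPerm a) L b ∧ G.ChainFromTo (C.formPerm b) M a := by
  obtain ⟨c, C', hc, hac, hC', hr⟩ := hC.exists_rotation_last ha
  obtain ⟨K, rfl⟩ := hc.exists_eq_concat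
  have hbK : b ∈ K := by
    have := hr.mem_iff.1 hb
    simpa [hab.symm] using this
  obtain ⟨L, M, rfl⟩ := List.append_of_mem hbK
  have hn := hC'.1
  have e1 : C.formPerm = (L ++ b :: M ++ [a]).formPerm := List.formPerm_eq_of_isRotated hC.1 hr
  have hr2 : L ++ b :: M ++ [a] ~r (M ++ [a]) ++ (L ++ [b]) := by
    simpa using List.isRotated_append (l := L ++ [b]) (l' := M ++ [a])
  have e2 : C.formPerm = ((M ++ [a]) ++ (L ++ [b])).formPerm := by
    rw [e1]; exact List.formPerm_eq_of_isRotated hn hr2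
  have key : ∀ (K : List V) (u v : V), K.head? = some v → K.getLast? = some u →
      K.formPerm u = v := by
    rintro (_ | ⟨w, K⟩) u v h h'
    · simp at h
    · have := List.formPerm_apply_getLast w K
      rw [List.getLast?_eq_some_getLast (by simp)] at h'
      rw [Option.some.inj h'] at this
      exact this.trans (by simpa using h)
  have hsplit : ∃ d, G.ChainFromTo c (L ++ [b]) b ∧ G.ChainFromTo d (M ++ [a]) a := by
    rcases M with _ | ⟨d, M⟩
    · have := ChainFromTo.split (L := L) (c := b) (d := a) (M := []) (by simpa using hc)
      exact ⟨a, this.1, this.2.2⟩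
    · have := ChainFromTo.split (L := L) (c := b) (d := d) (M := M ++ [a]) (by simpa using hc)
      exact ⟨d, this.1, this.2.2⟩
  obtain ⟨d, h1, h2⟩ := hsplit
  have ea : C.formPerm a = c := by
    rw [e1]; exact key _ a c hc.1 hc.2.1
  have eb : C.formPerm b = d := by
    rw [e2]; exact key _ b d (by rw [List.head?_append, h2.1]; rfl)
      (by rw [← List.append_assoc, List.getLast?_concat])
  refine ⟨L ++ [b], M ++ [a], by simpa using hr, ?_, ?_⟩
  · rwa [ea]
  · rwa [eb]

theorem IsCyclicList.formPerm_of_rotated_cons (hC : G.IsCyclicList C) {f g : V} {L : List V}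
    (hr : C ~r f :: g :: L) : C.formPerm f = g := by
  rw [List.formPerm_eq_of_isRotated hC.1 hr]
  exact List.formPerm_apply_head f g L (hr.perm.nodup_iff.1 hC.1)

/-- Extension of a path on `C` at its start `f` by a partner of `f`. -/
theorem IsPartner.exists_extension {f s : V} (hs : G.IsPartner x C f s) {L : List V}
    (hL : G.ChainFromTo f (f :: C.formPerm f :: L) b) (hn : (f :: C.formPerm f :: L).Nodup)
    (hLC : ∀ v ∈ f :: C.formPerm f :: L, v ∈ C) :
    ∃ e₁ e₂ R, ((e₁ = s ∧ e₂ = f) ∨ (e₁ = f ∧ e₂ = s)) ∧ G.ChainFromTo e₁ (e₁ :: e₂ :: R) b ∧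
      (e₁ :: e₂ :: R).Nodup ∧ (∀ v ∈ e₁ :: e₂ :: R, v = s ∨ v ∈ f :: C.formPerm f :: L) ∧
      (∀ v ∈ f :: C.formPerm f :: L, v ∈ e₂ :: R ∨
        (v = f ∧ ∀ w, w ∉ C → w ≠ x → ¬ G.Adj f w)) ∧
      ((s ∉ C ∧ s ≠ x ∧ G.Adj f s) ∨ s ∈ f :: C.formPerm f :: L) := by
  rcases hs with hs | ⟨rfl, hs⟩
  · refine ⟨s, f, C.formPerm f :: L, Or.inl ⟨rfl, rfl⟩, hL.cons hs.2.2.symm, ?_, ?_, ?_, Or.inl hs⟩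
    · exact List.nodup_cons.2 ⟨fun h => hs.1 (hLC s h), hn⟩
    · simp
    · exact fun v hv => Or.inl hv
  · refine ⟨f, C.formPerm f, L, Or.inr ⟨rfl, rfl⟩, hL, hn, fun v hv => Or.inr hv, ?_, by simp⟩
    intro v hv
    rcases List.mem_cons.1 hv with rfl | hv
    · exact Or.inr ⟨rfl, hs⟩
    · exact Or.inl hv

/-- Cut C behind a and b. If paths as in `not_adj` had adjacent starts, `isCyclicList_join` would
close them up with P to a reroute containing P, against `hN`. Dropping a first vertex is harmless:
it is off C, or it is a successor without neighbours outside C and x, and the two successors are not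
adjacent by `hfg`. -/
theorem IsCyclicList.exists_isUnjoinable (hC : G.IsCyclicList C) (hx : x ∉ C) (ha : a ∈ C)
    (hb : b ∈ C) (hab : a ≠ b) {s t : V} (hs : G.IsPartner x C (C.formPerm a) s)
    (ht : G.IsPartner x C (C.formPerm b) t) {p q : V} {P : List V} (hP : G.ChainFromTo p P q)
    (hPn : P.Nodup) (hap : G.Adj a p) (hqb : G.Adj q b) (hPC : ∀ v ∈ P, v ∉ C ∧ v ≠ x)
    (hPa : ∀ v ∈ P, ¬ G.Adj (C.formPerm a) v) (hPb : ∀ v ∈ P, ¬ G.Adj (C.formPerm b) v)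
    (hN : ∀ C', G.IsReroute x C C' → ∃ v ∈ P, v ∉ C') :
    ∃ e₁ e₂ R c₁ c₂ Q, ((e₁ = s ∧ e₂ = C.formPerm a) ∨ (e₁ = C.formPerm a ∧ e₂ = s)) ∧
      ((c₁ = t ∧ c₂ = C.formPerm b) ∨ (c₁ = C.formPerm b ∧ c₂ = t)) ∧
      G.IsUnjoinable (fun v => v ∉ P ∧ v ≠ x) a b e₁ e₂ R c₁ c₂ Q ∧
      ∀ v ∈ e₁ :: e₂ :: R ++ c₁ :: c₂ :: Q, v ∈ C ∨ v = s ∨ v = t := by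
  obtain ⟨L, M, hr, hL, hM⟩ := hC.exists_split ha hb hab
  have hCM : ∀ v, v ∈ C ↔ v ∈ L ∨ v ∈ M := fun v => by rw [hr.mem_iff, List.mem_append]
  have hn := hr.perm.nodup_iff.1 hC.1
  obtain ⟨hLn, hMn, hLM⟩ := List.nodup_append.1 hn
  have hdrop : ∀ S T : List V, G.IsCyclicList (P ++ (S ++ T)) → x ∉ S ++ T →
      (∀ v ∈ C, v ∉ S ++ T → ∀ w, w ∉ C → w ≠ x → ¬ G.Adj v w) →
      (∀ u ∈ C, ∀ v ∈ C, u ∉ S ++ T → v ∉ S ++ T → ¬ G.Adj u v) → False := by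
    intro S T h1 h2 h3 h4
    have hre : G.IsReroute x C (P ++ (S ++ T)) := ⟨h1, ?_, ?_, ?_⟩
    · obtain ⟨v, hv, hv'⟩ := hN _ hre
      exact hv' (List.mem_append_left _ hv)
    · rw [List.mem_append]
      rintro (h | h)
      exacts [(hPC x h).2 rfl, h2 h]
    · exact fun v hv hv' => h3 v hv fun h => hv' (List.mem_append_right _ h)
    · exact fun u hu v hv hu' hv' => h4 u hu v hv (fun h => hu' (List.mem_append_right _ h))
        fun h => hv' (List.mem_append_right _ h)
  have hfull : ∀ S T : List V, G.IsCyclicList (P ++ (S ++ T)) → x ∉ S ++ T →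
      (∀ v ∈ C, v ∈ S ++ T) → False := fun S T h1 h2 h3 =>
    hdrop S T h1 h2 (fun v hv h => absurd (h3 v hv) h) (fun u hu v hv h => absurd (h3 u hu) h)
  have hnP : ∀ S : List V, S.Nodup → (∀ v ∈ S, v ∉ P) → (P ++ S).Nodup := fun S h1 h2 =>
    List.nodup_append.2 ⟨hPn, h1, fun u hu v hv e => h2 v hv (e ▸ hu)⟩
  have hCP : ∀ v ∈ C, v ∉ P := fun v hv hv' => (hPC v hv').1 hv
  have hfg : ¬ G.Adj (C.formPerm a) (C.formPerm b) := by
    intro h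
    have h1 := hP.isCyclicList_join hL hM hap hqb h
      (hnP _ hn fun v hv => hCP v (hr.mem_iff.2 hv))
    refine hfull _ _ h1 ?_ ?_
    · intro h2; apply hx; rw [hCM]; simpa using h2
    · intro v hv; rw [hCM] at hv; simpa using hv
  have hcom : ∀ w, w ∉ C → w ≠ x → G.Adj (C.formPerm a) w → ¬ G.Adj (C.formPerm b) w := by
    intro w hwC hwx h1 h2
    have hwP : w ∉ P := fun h => hPa w h h1
    have hp : (L ++ w :: M).Perm (w :: (L ++ M)) := List.perm_middle
    have h3 := hP.isCyclicList_join hL (hM.cons h2.symm) hap hqb h1 (hnP _ ?_ ?_)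
    · refine hfull _ _ h3 ?_ ?_
      · intro h4; apply hx; rw [hCM]; simpa [hwx.symm] using h4
      · intro v hv
        rw [hCM] at hv
        simp only [List.mem_append, List.mem_reverse, List.mem_cons]
        tauto
    · rw [hp.nodup_iff, List.nodup_cons]
      exact ⟨fun h => hwC (hr.mem_iff.2 h), hn⟩
    · intro v hv
      rw [hp.mem_iff, List.mem_cons] at hv
      rcases hv with rfl | hv
      exacts [hwP, hCP v (hr.mem_iff.2 hv)]
  have hform : ∀ (c d : V) (K N : List V), C ~r K ++ N → G.ChainFromTo c K d → c ≠ d →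
      ∃ K', K = c :: C.formPerm c :: K' := by
    intro c d K N hrK hK hcd
    obtain ⟨K', rfl⟩ := hK.exists_eq_cons
    rcases K' with _ | ⟨e, K'⟩
    · exact absurd (by simpa using hK.2.1) hcd
    · exact ⟨K', by rw [hC.formPerm_of_rotated_cons (by simpa using hrK)]⟩
  -- Neither arc is a single vertex: the successor of a is not b, because only the latter is
  -- adjacent to q, and similarly with p at the other side.
  obtain ⟨L', rfl⟩ := hform _ _ L M hr hL fun h => hPa q hP.last_mem (h ▸ hqb.symm)
  obtain ⟨M', rfl⟩ := hform _ _ M _ (hr.trans List.isRotated_append) hM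
    fun h => hPb p hP.head_mem (h ▸ hap)
  obtain ⟨e₁, e₂, R, he, hR, hRn, hRm, hRc, hs'⟩ :=
    hs.exists_extension hL hLn fun v hv => (hCM v).2 (Or.inl hv)
  obtain ⟨c₁, c₂, Q, hc, hQ, hQn, hQm, hQc, ht'⟩ :=
    ht.exists_extension hM hMn fun v hv => (hCM v).2 (Or.inr hv)
  refine ⟨e₁, e₂, R, c₁, c₂, Q, he, hc, ⟨hR, hQ, ?_, ?_, ?_⟩, ?_⟩
  · refine List.nodup_append.2 ⟨hRn, hQn, ?_⟩
    rintro v hv _ hv' rfl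
    have hv1 : (v ∉ C ∧ v ≠ x ∧ G.Adj (C.formPerm a) v) ∨
        v ∈ C.formPerm a :: C.formPerm (C.formPerm a) :: L' := by
      rcases hRm v hv with rfl | h
      exacts [hs', Or.inr h]
    have hv2 : (v ∉ C ∧ v ≠ x ∧ G.Adj (C.formPerm b) v) ∨
        v ∈ C.formPerm b :: C.formPerm (C.formPerm b) :: M' := by
      rcases hQm v hv' with rfl | h
      exacts [ht', Or.inr h]
    rcases hv1 with h1 | h1 <;> rcases hv2 with h2 | h2
    · exact hcom v h1.1 h1.2.1 h1.2.2 h2.2.2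
    · exact h1.1 ((hCM v).2 (Or.inr h2))
    · exact h2.1 ((hCM v).2 (Or.inl h1))
    · exact hLM v h1 v h2 rfl
  · intro v hv
    rw [List.mem_append] at hv
    have hCok : v ∈ C → v ∉ P ∧ v ≠ x := fun h => ⟨hCP v h, fun e => hx (e ▸ h)⟩
    rcases hv with hv | hv
    · rcases hRm v hv with rfl | h
      · rcases hs' with h | h
        · exact ⟨fun h' => hPa v h' h.2.2, h.2.1⟩
        · exact hCok ((hCM v).2 (Or.inl h))
      · exact hCok ((hCM v).2 (Or.inl h))
    · rcases hQm v hv with rfl | h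
      · rcases ht' with h | h
        · exact ⟨fun h' => hPb v h' h.2.2, h.2.1⟩
        · exact hCok ((hCM v).2 (Or.inr h))
      · exact hCok ((hCM v).2 (Or.inr h))
  · intro u S w T hS hT hST hok h1 h2 huw
    have hm : ∀ v, v ∈ S.reverse ++ T ↔ v ∈ S ++ T := by simp
    have hc := hP.isCyclicList_join hS hT hap hqb huw (hnP _ hST fun v hv => (hok v hv).1)
    have hmiss : ∀ v ∈ C, v ∉ S.reverse ++ T →
        (v = C.formPerm a ∨ v = C.formPerm b) ∧ ∀ w, w ∉ C → w ≠ x → ¬ G.Adj v w := by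
      intro v hv hv'
      rw [hm] at hv'
      rcases (hCM v).1 hv with h | h
      · rcases hRc v h with h | ⟨rfl, h'⟩
        · exact absurd (h1 v h) hv'
        · exact ⟨Or.inl rfl, h'⟩
      · rcases hQc v h with h | ⟨rfl, h'⟩
        · exact absurd (h2 v h) hv'
        · exact ⟨Or.inr rfl, h'⟩
    refine hdrop _ _ hc (fun h => (hok x ((hm x).1 h)).2 rfl)
      (fun v hv hv' => (hmiss v hv hv').2) ?_
    intro u hu v hv hu' hv'
    rcases (hmiss u hu hu').1 with rfl | rfl <;> rcases (hmiss v hv hv').1 with rfl | rfl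
    exacts [G.irrefl, hfg, fun h => hfg h.symm, G.irrefl]
  · intro v hv
    rw [List.mem_append] at hv
    rcases hv with hv | hv
    · rcases hRm v hv with h | h
      exacts [Or.inr (Or.inl h), Or.inl ((hCM v).2 (Or.inl h))]
    · rcases hQm v hv with h | h
      exacts [Or.inr (Or.inr h), Or.inl ((hCM v).2 (Or.inr h))]

theorem IsCyclicList.exists_rotation_succ (hC : G.IsCyclicList C) (ha : a ∈ C) :
    ∃ K, G.ChainFromTo (C.formPerm a) (C.formPerm a :: K) a ∧ C ~r C.formPerm a :: K := by
  obtain ⟨c, C', hc, -, hC', hr⟩ := hC.exists_rotation_last ha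
  obtain ⟨K, rfl⟩ := hc.exists_eq_cons
  have hfc : C.formPerm a = c := by
    rw [List.formPerm_eq_of_isRotated hC.1 hr]
    have h1 := List.formPerm_apply_getLast c K
    have h2 := hc.2.1
    rw [List.getLast?_eq_some_getLast (by simp)] at h2
    rwa [Option.some.inj h2] at h1
  rw [hfc]
  exact ⟨K, hc, hr⟩

/-- Insertion of a path between `a` and its successor. -/
theorem IsCyclicList.exists_insert (hC : G.IsCyclicList C) (ha : a ∈ C) {p q : V} {P : List V}
    (hP : G.ChainFromTo p P q) (hPn : P.Nodup) (hPC : ∀ v ∈ P, v ∉ C) (hap : G.Adj a p)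
    (hq : G.Adj q (C.formPerm a)) : ∃ C', G.IsCyclicList C' ∧ C'.Perm (C ++ P) := by
  obtain ⟨K, hK, hr⟩ := hC.exists_rotation_succ ha
  have hp := (hr.perm.append_right P).symm
  refine ⟨_, IsCyclicList.mk' (hK.append hP hap) hq (hp.nodup_iff.2 ?_), hp⟩
  exact List.nodup_append.2 ⟨hC.1, hPn, fun u hu v hv e => hPC v hv (e ▸ hu)⟩

/-- Replacement of the successor of `a` by a path. -/
theorem IsCyclicList.exists_replace (hC : G.IsCyclicList C) (ha : a ∈ C) {p q : V} {P : List V}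
    (hP : G.ChainFromTo p P q) (hPn : P.Nodup) (hPC : ∀ v ∈ P, v ∉ C) (hap : G.Adj a p)
    (hq : G.Adj q (C.formPerm (C.formPerm a))) :
    ∃ C', G.IsCyclicList C' ∧ (C.formPerm a :: C').Perm (C ++ P) := by
  obtain ⟨K, hK, hr⟩ := hC.exists_rotation_succ ha
  rcases K with _ | ⟨d, K⟩
  · have := (hC.of_isRotated hr).two_le_length
    simp at this
  have hd := hC.formPerm_of_rotated_cons hr
  have hp : (C.formPerm a :: (d :: K ++ P)).Perm (C ++ P) := (hr.perm.append_right P).symm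
  refine ⟨_, IsCyclicList.mk' (hK.tail.2.append hP hap) (hd ▸ hq) ?_, hp⟩
  refine (List.nodup_cons.1 (hp.nodup_iff.2 ?_)).2
  exact List.nodup_append.2 ⟨hC.1, hPn, fun u hu v hv e => hPC v hv (e ▸ hu)⟩

/-- Otherwise P could be inserted between a and its successor, or could replace the successor when
the partner is the vertex after it. In the latter case the dropped successor has no neighbours
outside C and x, so both cycles are reroutes. -/
theorem IsCyclicList.not_adj_succ_and_partner (hC : G.IsCyclicList C) (hx : x ∉ C) (ha : a ∈ C)
    {s : V} (hs : G.IsPartner x C (C.formPerm a) s) {p q : V} {P : List V}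
    (hP : G.ChainFromTo p P q) (hPn : P.Nodup) (hap : G.Adj a p) (hPC : ∀ v ∈ P, v ∉ C ∧ v ≠ x)
    (hN : ∀ C', G.IsReroute x C C' → ∃ v ∈ P, v ∉ C') :
    ¬ G.Adj (C.formPerm a) q ∧ (s ∈ C → ¬ G.Adj s q) := by
  have hxn : x ∉ C ++ P := by
    rw [List.mem_append]
    rintro (h | h)
    exacts [hx h, (hPC x h).2 rfl]
  constructor
  · intro h
    obtain ⟨C', hC', hp⟩ := hC.exists_insert ha hP hPn (fun v hv => (hPC v hv).1) hap h.symm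
    have hsub : ∀ v ∈ C, v ∈ C' := fun v hv => hp.mem_iff.2 (List.mem_append_left _ hv)
    obtain ⟨v, hv, hv'⟩ := hN C' ⟨hC', fun h => hxn (hp.mem_iff.1 h),
      fun v hv hv' => absurd (hsub v hv) hv', fun v hv w _ hv' => absurd (hsub v hv) hv'⟩
    exact hv' (hp.mem_iff.2 (List.mem_append_right _ hv))
  · intro hsC h
    rcases hs with hs | ⟨rfl, hs'⟩
    · exact hs.1 hsC
    obtain ⟨C', hC', hp⟩ := hC.exists_replace ha hP hPn (fun v hv => (hPC v hv).1) hap h.symm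
    have hmiss : ∀ v ∈ C, v ∉ C' → v = C.formPerm a := by
      intro v hv hv'
      have := hp.mem_iff.2 (List.mem_append_left _ hv)
      exact (List.mem_cons.1 this).resolve_right hv'
    obtain ⟨v, hv, hv'⟩ := hN C' ⟨hC',
      fun h => hxn (hp.mem_iff.1 (List.mem_cons_of_mem _ h)),
      fun v hv hv' => by rw [hmiss v hv hv']; exact hs',
      fun u hu v hv hu' hv' => by rw [hmiss u hu hu', hmiss v hv hv']; exact G.irrefl⟩
    rcases List.mem_cons.1 (hp.mem_iff.2 (List.mem_append_right _ hv)) with rfl | h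
    · exact (hPC _ hv).1 (List.formPerm_apply_mem_of_mem ha)
    · exact hv' h

/-- The edges formed by the successors of `a` and `b` on `C` and their partners are remote, and
few vertices are adjacent to them. -/
theorem IsCyclicList.remote_partners [Fintype V] (hC : G.IsCyclicList C) (hx : x ∉ C) (ha : a ∈ C)
    (hb : b ∈ C) (hab : a ≠ b) {s t : V} (hs : G.IsPartner x C (C.formPerm a) s)
    (ht : G.IsPartner x C (C.formPerm b) t) {p q : V} {P : List V} (hP : G.ChainFromTo p P q)
    (hPn : P.Nodup) (hap : G.Adj a p) (hqb : G.Adj q b) {H : Finset V} (hPH : ∀ v ∈ P, v ∈ H)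
    (hHC : ∀ v ∈ H, v ∉ C ∧ v ≠ x)
    (hHa : ∀ v ∈ H, ¬ G.Adj (C.formPerm a) v ∧ ¬ G.Adj s v)
    (hHb : ∀ v ∈ H, ¬ G.Adj (C.formPerm b) v ∧ ¬ G.Adj t v)
    (hN : ∀ C', G.IsReroute x C C' → ∃ v ∈ P, v ∉ C') :
    (∀ u w, (u = C.formPerm a ∨ u = s) → (w = C.formPerm b ∨ w = t) → u ≠ w ∧ ¬ G.Adj u w) ∧
      (∀ v, v ∉ C → v ≠ x → v ∉ P → ¬ (v ∈ G.edgeNbhd (C.formPerm a) s ∧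
        v ∈ G.edgeNbhd (C.formPerm b) t)) ∧
      (G.edgeNbhd (C.formPerm a) s \ {x}).card + (G.edgeNbhd (C.formPerm b) t \ {x}).card +
        H.card + 3 ≤ Fintype.card V := by
  obtain ⟨e₁, e₂, R, c₁, c₂, Q, he, hc, hU, hm⟩ := hC.exists_isUnjoinable hx ha hb hab hs ht hP
    hPn hap hqb (fun v hv => hHC v (hPH v hv)) (fun v hv => (hHa v (hPH v hv)).1)
    (fun v hv => (hHb v (hPH v hv)).1) hN
  have hH : ∀ v ∈ H, v ∉ e₁ :: e₂ :: R ++ c₁ :: c₂ :: Q := by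
    intro v hv hv'
    rcases hm v hv' with h | rfl | rfl
    · exact (hHC v hv).1 h
    · rcases hs with h | ⟨h, -⟩
      · exact (hHa v hv).1 h.2.2
      · exact (hHC v hv).1 (h ▸ List.formPerm_apply_mem_of_mem (List.formPerm_apply_mem_of_mem ha))
    · rcases ht with h | ⟨h, -⟩
      · exact (hHb v hv).1 h.2.2
      · exact (hHC v hv).1 (h ▸ List.formPerm_apply_mem_of_mem (List.formPerm_apply_mem_of_mem hb))
  have he' : G.edgeNbhd (C.formPerm a) s = G.edgeNbhd e₁ e₂ := by
    rcases he with ⟨rfl, rfl⟩ | ⟨rfl, rfl⟩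
    exacts [edgeNbhd_comm, rfl]
  have hc' : G.edgeNbhd (C.formPerm b) t = G.edgeNbhd c₁ c₂ := by
    rcases hc with ⟨rfl, rfl⟩ | ⟨rfl, rfl⟩
    exacts [edgeNbhd_comm, rfl]
  have hdis := List.nodup_append.1 hU.nodup
  refine ⟨?_, ?_, ?_⟩
  · intro u w hu hw
    have hu' : u = e₁ ∨ u = e₂ := by
      rcases he with ⟨rfl, rfl⟩ | ⟨rfl, rfl⟩
      exacts [hu.symm, hu]
    have hw' : w = c₁ ∨ w = c₂ := by
      rcases hc with ⟨rfl, rfl⟩ | ⟨rfl, rfl⟩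
      exacts [hw.symm, hw]
    refine ⟨hdis.2.2 u ?_ w ?_, hU.not_adj_of_left_right hu' hw'⟩
    · rcases hu' with rfl | rfl <;> simp
    · rcases hw' with rfl | rfl <;> simp
  · rintro v hvC hvx hvP ⟨h1, h2⟩
    rw [he'] at h1
    rw [hc'] at h2
    rw [mem_edgeNbhd] at h1 h2
    by_cases hv : v ∈ e₁ :: e₂ :: R ++ c₁ :: c₂ :: Q
    · have : v = s ∨ v = t := (hm v hv).resolve_left hvC
      rcases this with rfl | rfl
      · rcases he with ⟨rfl, rfl⟩ | ⟨rfl, rfl⟩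
        exacts [h1.2.1 rfl, h1.2.2 rfl]
      · rcases hc with ⟨rfl, rfl⟩ | ⟨rfl, rfl⟩
        exacts [h2.2.1 rfl, h2.2.2 rfl]
    · have := fun u w => hU.not_common (u := u) (w := w) ⟨hvP, hvx⟩ hv
      rcases h1.1 with h1 | h1 <;> rcases h2.1 with h2 | h2
      · exact this _ _ (Or.inl rfl) (Or.inl rfl) ⟨h1, h2⟩
      · exact this _ _ (Or.inl rfl) (Or.inr rfl) ⟨h1, h2⟩
      · exact this _ _ (Or.inr rfl) (Or.inl rfl) ⟨h1, h2⟩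
      · exact this _ _ (Or.inr rfl) (Or.inr rfl) ⟨h1, h2⟩
  · rw [he', hc']
    refine hU.card_add_card_le ?_ ?_ (fun h => (hHC x h).2 rfl) hH ?_ ?_
    · exact fun h => (hU.ok_of_mem x h).2 rfl
    · exact fun v hv hvH => ⟨fun h => hvH (hPH v h), hv⟩
    · intro v hv h
      rw [← he', mem_edgeNbhd] at h
      exact h.1.elim (hHa v hv).1 (hHa v hv).2
    · intro v hv h
      rw [← hc', mem_edgeNbhd] at h
      exact h.1.elim (hHb v hv).1 (hHb v hv).2

end Reroute

end SimpleGraph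

/-! ### A cycle dominating all edges of G - x. -/

namespace SimpleGraph

section Dominating

variable {V : Type*} {G : SimpleGraph V} {C : List V} {a b x : V}

theorem Walk.chainFromTo_support {u v : V} (p : G.Walk u v) : G.ChainFromTo u p.support v := by
  refine ⟨?_, ?_, p.isChain_adj_support⟩
  · rw [List.head?_eq_some_head p.support_ne_nil, p.head_support]
  · rw [List.getLast?_eq_some_getLast p.support_ne_nil, p.getLast_support]

variable [DecidableEq V]

theorem IsCyclicList.adj_formPerm (hC : G.IsCyclicList C) (ha : a ∈ C) :
    G.Adj a (C.formPerm a) := by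
  obtain ⟨K, hK, hr⟩ := hC.exists_rotation_succ ha
  obtain ⟨b, hb, hba⟩ := (hC.of_isRotated hr).chain
  have : b = a := Option.some.inj (hb.2.1.symm.trans hK.2.1)
  exact this ▸ hba

theorem IsPartner.adj (hC : G.IsCyclicList C) (ha : a ∈ C) {s : V} (hs : G.IsPartner x C a s) :
    G.Adj a s := by
  rcases hs with hs | ⟨rfl, -⟩
  exacts [hs.2.2, hC.adj_formPerm ha]

theorem card_le_card_sdiff_singleton_add_one (N : Finset V) (x : V) :
    N.card ≤ (N \ {x}).card + 1 := by
  have := Finset.le_card_sdiff {x} N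
  rw [Finset.card_singleton] at this
  omega

variable [Fintype V]

/-- Remote edges have degree sum at least `|V| - 3`. -/
def HasLargeRemoteDegrees (G : SimpleGraph V) : Prop :=
  ∀ u v w z, G.Adj u v → G.Adj w z →
    (∀ a b, (a = u ∨ a = v) → (b = w ∨ b = z) → a ≠ b ∧ ¬ G.Adj a b) →
    Fintype.card V ≤ (G.edgeNbhd u v).card + (G.edgeNbhd w z).card + 3

/-- If no cycle obtained by rerouting `C` meets the component `H` of `G - C - x`, which has at
least two vertices, then toughness or the degree condition is violated. -/
theorem IsCyclicList.false_of_component (hC : G.IsCyclicList C) (hx : x ∉ C)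
    (ht : G.IsStrictlyTough) (hd : G.HasLargeRemoteDegrees) {H : Finset V}
    (hH2 : ∃ u ∈ H, ∃ v ∈ H, G.Adj u v) (hHC : ∀ v ∈ H, v ∉ C ∧ v ≠ x)
    (hHcl : ∀ u ∈ H, ∀ v, v ∉ C → v ≠ x → G.Adj u v → v ∈ H)
    (hHconn : ∀ p ∈ H, ∀ q ∈ H, ∃ P, G.ChainFromTo p P q ∧ P.Nodup ∧ ∀ v ∈ P, v ∈ H)
    (hmin : ∀ C', G.IsReroute x C C' → ∀ v ∈ H, v ∉ C') : False := by
  classical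
  obtain ⟨u, hu, v, hv, huv⟩ := hH2
  have hN : ∀ P p q, G.ChainFromTo p P q → (∀ v ∈ P, v ∈ H) →
      ∀ C', G.IsReroute x C C' → ∃ v ∈ P, v ∉ C' := fun P p q hP hPH C' hC' =>
    ⟨p, hP.head_mem, hmin C' hC' p (hPH p hP.head_mem)⟩
  set T : Finset V := C.toFinset.filter fun a => ∃ h ∈ H, G.Adj a h with hT
  have hTm : ∀ a, a ∈ T ↔ a ∈ C ∧ ∃ h ∈ H, G.Adj a h := fun a => by simp [hT]
  choose s hs using fun a => exists_isPartner (G := G) x C (C.formPerm a)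
  have hσ : ∀ a ∈ T, C.formPerm a ∈ C := fun a ha =>
    List.formPerm_apply_mem_of_mem ((hTm a).1 ha).1
  have hna : ∀ a ∈ T, ∀ h ∈ H, ¬ G.Adj (C.formPerm a) h ∧ ¬ G.Adj (s a) h := by
    intro a ha h hh
    obtain ⟨haC, p, hp, hap⟩ := (hTm a).1 ha
    have key : ∀ h ∈ H, ¬ G.Adj (C.formPerm a) h ∧ (s a ∈ C → ¬ G.Adj (s a) h) := by
      intro h hh
      obtain ⟨P, hP, hPn, hPH⟩ := hHconn p hp h hh
      exact hC.not_adj_succ_and_partner hx haC (hs a) hP hPn hap (fun v hv => hHC v (hPH v hv))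
        (hN P p h hP hPH)
    refine ⟨(key h hh).1, fun hsh => ?_⟩
    rcases hs a with h1 | ⟨h1, -⟩
    · exact (key _ (hHcl h hh _ h1.1 h1.2.1 hsh.symm)).1 h1.2.2
    · exact (key h hh).2 (h1 ▸ List.formPerm_apply_mem_of_mem (hσ a ha)) hsh
  have hadj : ∀ a ∈ T, G.Adj (C.formPerm a) (s a) := fun a ha => (hs a).adj hC (hσ a ha)
  have hsx : ∀ a ∈ T, s a ≠ x ∧ s a ∉ H := by
    intro a ha
    rcases hs a with h1 | ⟨h1, -⟩
    · exact ⟨h1.2.1, fun h => (hna a ha _ h).1 h1.2.2⟩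
    · have : s a ∈ C := h1 ▸ List.formPerm_apply_mem_of_mem (hσ a ha)
      exact ⟨fun h => hx (h ▸ this), fun h => (hHC _ h).1 this⟩
  have hσT : ∀ a ∈ T, C.formPerm a ∉ T := by
    intro a ha h
    obtain ⟨-, p, hp, hap⟩ := (hTm _).1 h
    exact (hna a ha p hp).1 hap
  have hsT : ∀ a ∈ T, s a ∉ T := by
    intro a ha h
    obtain ⟨-, p, hp, hap⟩ := (hTm _).1 h
    exact (hna a ha p hp).2 hap
  have hxT : x ∉ T := fun h => hx ((hTm x).1 h).1
  have hHT : ∀ a ∈ T, a ∉ H := fun a ha h => (hHC a h).1 ((hTm a).1 ha).1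
  -- the component has at least two neighbours on the cycle
  have hT2 : 2 ≤ T.card := by
    obtain ⟨c, hcC, hcT⟩ : ∃ c ∈ C, c ∉ T := by
      by_cases hne : ∃ a, a ∈ T
      · obtain ⟨a, ha⟩ := hne
        exact ⟨_, hσ a ha, hσT a ha⟩
      · push Not at hne
        obtain ⟨-, a, b, h, -⟩ := hC
        exact ⟨a, h.head_mem, hne a⟩
    -- Deleting x and T separates H from the vertex c of the cycle, so 2 < |T| + 1.
    have := ht.card_lt (S := insert x T) (κ := Bool) (fun v => decide (v ∈ H)) ?_ ?_ (by simp)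
    · rw [Finset.card_insert_of_notMem hxT, Fintype.card_bool] at this
      omega
    · have key : ∀ u v, v ∉ insert x T → G.Adj u v → u ∈ H → v ∈ H := by
        intro u v hv huv huH
        rw [Finset.mem_insert, not_or] at hv
        by_cases hvC : v ∈ C
        · exact absurd ((hTm v).2 ⟨hvC, u, huH, huv.symm⟩) hv.2
        · exact hHcl u huH v hvC hv.1 huv
      intro u v hu hv huv
      simp only [decide_eq_decide]
      exact ⟨key u v hv huv, key v u hu huv.symm⟩
    · rintro (_ | _)
      · refine ⟨c, ?_, ?_⟩
        · rw [Finset.mem_insert, not_or]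
          exact ⟨fun h => hx (h ▸ hcC), hcT⟩
        · simpa using fun h => (hHC c h).1 hcC
      · refine ⟨u, ?_, by simpa using hu⟩
        rw [Finset.mem_insert, not_or]
        exact ⟨(hHC u hu).2, fun h => hHT u h hu⟩
  have hpair : ∀ a ∈ T, ∀ b ∈ T, a ≠ b →
      (∀ u w, (u = C.formPerm a ∨ u = s a) → (w = C.formPerm b ∨ w = s b) →
        u ≠ w ∧ ¬ G.Adj u w) ∧
      (G.edgeNbhd (C.formPerm a) (s a) \ {x}).card +
        (G.edgeNbhd (C.formPerm b) (s b) \ {x}).card + H.card + 3 ≤ Fintype.card V := by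
    intro a ha b hb hab
    obtain ⟨haC, p, hp, hap⟩ := (hTm a).1 ha
    obtain ⟨hbC, q, hq, hbq⟩ := (hTm b).1 hb
    obtain ⟨P, hP, hPn, hPH⟩ := hHconn p hp q hq
    obtain ⟨h1, -, h2⟩ := hC.remote_partners hx haC hbC hab (hs a) (hs b) hP hPn hap hbq.symm hPH
      hHC (hna a ha) (hna b hb) (hN P p q hP hPH)
    exact ⟨h1, h2⟩
  have hHle : ({u, v} : Finset V) ⊆ H := by
    intro w hw
    rw [Finset.mem_insert, Finset.mem_singleton] at hw
    rcases hw with rfl | rfl <;> assumption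
  have hcard2 : ({u, v} : Finset V).card = 2 := Finset.card_pair huv.ne
  have hle := Finset.card_le_card hHle
  obtain ⟨a, ha, b, hb, hab⟩ := Finset.one_lt_card.1 hT2
  obtain ⟨hrem, hcnt⟩ := hpair a ha b hb hab
  have hdab := hd _ _ _ _ (hadj a ha) (hadj b hb) hrem
  have k1 := card_le_card_sdiff_singleton_add_one (G.edgeNbhd (C.formPerm a) (s a)) x
  have k2 := card_le_card_sdiff_singleton_add_one (G.edgeNbhd (C.formPerm b) (s b)) x
  -- The crossing bound, with a loss of at most one for x in each neighbourhood, and the degree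
  -- condition together give |H| ≤ 2.
  have hHeq : ({u, v} : Finset V) = H := Finset.eq_of_subset_of_card_le hHle (by omega)
  have hd0 : (G.edgeNbhd u v).card ≤ T.card + 1 := by
    rw [← Finset.card_insert_of_notMem hxT]
    refine Finset.card_le_card fun w hw => ?_
    obtain ⟨h1, h2, h3⟩ := mem_edgeNbhd.1 hw
    rw [Finset.mem_insert]
    by_contra hcon
    rw [not_or] at hcon
    have key : ∀ p ∈ H, G.Adj p w → False := by
      intro p hp hpw
      by_cases hwC : w ∈ C
      · exact hcon.2 ((hTm w).2 ⟨hwC, p, hp, hpw.symm⟩)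
      · have := hHcl p hp w hwC hcon.1 hpw
        rw [← hHeq] at this
        simp [h2, h3] at this
    exact h1.elim (key u hu) (key v hv)
  have hrem0 : ∀ a ∈ T, Fintype.card V ≤
      (G.edgeNbhd u v).card + (G.edgeNbhd (C.formPerm a) (s a)).card + 3 := by
    intro a ha
    refine hd _ _ _ _ huv (hadj a ha) ?_
    intro p w hp hw
    have hpH : p ∈ H := by rcases hp with rfl | rfl <;> assumption
    rcases hw with rfl | rfl
    · exact ⟨fun h => (hHC p hpH).1 (h ▸ hσ a ha), fun h => (hna a ha p hpH).1 h.symm⟩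
    · exact ⟨fun h => (hsx a ha).2 (h ▸ hpH), fun h => (hna a ha p hpH).2 h.symm⟩
  have hda := hrem0 a ha
  have hdb := hrem0 b hb
  set U : Finset V := ((insert x H ∪ T) ∪ T.image C.formPerm) ∪ T.image s with hU
  have hUc : U.card = 1 + H.card + 3 * T.card := by
    have c1 : (T.image C.formPerm).card = T.card :=
      Finset.card_image_of_injective _ C.formPerm.injective
    have c2 : (T.image s).card = T.card := by
      refine Finset.card_image_of_injOn fun a ha b hb hab => ?_
      by_contra hne
      exact ((hpair a ha b hb hne).1 _ _ (Or.inr rfl) (Or.inr rfl)).1 hab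
    rw [hU, Finset.card_union_of_disjoint, Finset.card_union_of_disjoint,
      Finset.card_union_of_disjoint, Finset.card_insert_of_notMem fun h => (hHC x h).2 rfl, c1, c2]
    · ring
    · rw [Finset.disjoint_right]
      intro w hw h
      rcases Finset.mem_insert.1 h with rfl | h
      exacts [hxT hw, hHT w hw h]
    · rw [Finset.disjoint_right]
      intro w hw h
      obtain ⟨a, ha, rfl⟩ := Finset.mem_image.1 hw
      rcases Finset.mem_union.1 h with h | h
      · rcases Finset.mem_insert.1 h with h | h
        exacts [hx (h ▸ hσ a ha), (hHC _ h).1 (hσ a ha)]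
      · exact hσT a ha h
    · rw [Finset.disjoint_right]
      intro w hw h
      obtain ⟨a, ha, rfl⟩ := Finset.mem_image.1 hw
      rcases Finset.mem_union.1 h with h | h
      · rcases Finset.mem_union.1 h with h | h
        · rcases Finset.mem_insert.1 h with h | h
          exacts [(hsx a ha).1 h, (hsx a ha).2 h]
        · exact hsT a ha h
      · obtain ⟨b, hb, hab⟩ := Finset.mem_image.1 h
        by_cases hne : a = b
        · subst hne
          exact (hadj a ha).ne hab
        · exact ((hpair a ha b hb hne).1 _ _ (Or.inr rfl) (Or.inl rfl)).1 hab.symm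
  have hUle : U.card ≤ Fintype.card V := Finset.card_le_univ U
  -- With |H| = 2 the crossing bound gives d(e_a) + d(e_b) ≤ |V| - 3. Adding the conditions for uv
  -- against either edge, where d(uv) ≤ |T| + 1, yields |V| ≤ 2|T| + 5, while U has 3|T| + 3
  -- elements.
  have hT2' : T.card = 2 := by omega
  have hUuniv : U = Finset.univ := Finset.eq_univ_of_card U (by omega)
  have hTeq : ({a, b} : Finset V) = T := by
    refine Finset.eq_of_subset_of_card_le ?_ (by rw [Finset.card_pair hab, hT2'])
    intro w hw
    rw [Finset.mem_insert, Finset.mem_singleton] at hw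
    rcases hw with rfl | rfl <;> assumption
  have hcov : ∀ w, w ∉ insert x T → w ∈ H ∨ (w = C.formPerm a ∨ w = s a) ∨
      (w = C.formPerm b ∨ w = s b) := by
    intro w hw
    have : w ∈ U := hUuniv ▸ Finset.mem_univ w
    rw [← hTeq] at hw hU
    simp only [hU, Finset.mem_union, Finset.mem_insert, Finset.mem_image,
      Finset.mem_singleton, exists_eq_or_imp, exists_eq_left] at this hw
    have e : ∀ p q : V, p = q ↔ q = p := fun _ _ => eq_comm
    rw [e (C.formPerm a), e (C.formPerm b), e (s a), e (s b)] at this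
    tauto
  have hHno : ∀ c ∈ T, ∀ w, (w = C.formPerm c ∨ w = s c) → w ∉ H ∧ ∀ h ∈ H, ¬ G.Adj w h := by
    rintro c hc w (rfl | rfl)
    · exact ⟨fun h => (hHC _ h).1 (hσ c hc), fun h hh => (hna c hc h hh).1⟩
    · exact ⟨(hsx c hc).2, fun h hh => (hna c hc h hh).2⟩
  -- The remaining six vertices form three pairs, namely H and two partner edges, with no edges
  -- between them. So deleting three vertices would leave three components.
  have := ht.card_lt (S := insert x T) (κ := Fin 3)
    (fun w => if w ∈ H then 0 else if w = C.formPerm a ∨ w = s a then 1 else 2) ?_ ?_ (by simp)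
  · rw [Finset.card_insert_of_notMem hxT, Fintype.card_fin] at this
    omega
  · have key : ∀ p w, w ∉ insert x T → p ∈ H → G.Adj p w → w ∈ H := by
      intro p w hw hp hpw
      rcases hcov w hw with h | h | h
      · exact h
      · exact absurd hpw.symm ((hHno a ha w h).2 p hp)
      · exact absurd hpw.symm ((hHno b hb w h).2 p hp)
    intro p w hp hw hpw
    by_cases h1 : p ∈ H
    · rw [if_pos h1, if_pos (key p w hw h1 hpw)]
    · have h2 : w ∉ H := fun h => h1 (key w p hp h hpw.symm)
      rw [if_neg h1, if_neg h2]
      rcases (hcov p hp).resolve_left h1 with h3 | h3 <;>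
        rcases (hcov w hw).resolve_left h2 with h4 | h4
      · rw [if_pos h3, if_pos h4]
      · exact absurd hpw (hrem p w h3 h4).2
      · exact absurd hpw.symm (hrem w p h4 h3).2
      · rw [if_neg fun h => (hrem p p h h3).1 rfl, if_neg fun h => (hrem w w h h4).1 rfl]
  · have hmem : ∀ c ∈ T, C.formPerm c ∉ insert x T := by
      intro c hc h
      rcases Finset.mem_insert.1 h with h | h
      exacts [hx (h ▸ hσ c hc), hσT c hc h]
    intro k
    fin_cases k
    · refine ⟨u, ?_, by simp [hu]⟩
      rw [Finset.mem_insert, not_or]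
      exact ⟨(hHC u hu).2, fun h => hHT u h hu⟩
    · refine ⟨_, hmem a ha, ?_⟩
      simp [(hHno a ha _ (Or.inl rfl)).1]
    · refine ⟨_, hmem b hb, ?_⟩
      have h1 := (hHno b hb _ (Or.inl rfl)).1
      have h2 : ¬ (C.formPerm b = C.formPerm a ∨ C.formPerm b = s a) := fun h =>
        (hrem _ _ h (Or.inl rfl)).1 rfl
      simp only [if_neg h1, if_neg h2]
      rfl

/-- Some cycle avoiding `x` dominates all edges of `G - x`. -/
theorem IsStrictlyTough.exists_dominating_cycle (ht : G.IsStrictlyTough)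
    (hd : G.HasLargeRemoteDegrees) {y z : V} (hyx : y ≠ x) (hzx : z ≠ x) (hyz : G.Adj y z) :
    ∃ C, G.IsCyclicList C ∧ x ∉ C ∧ ∀ u v, u ∉ x :: C → v ∉ x :: C → ¬ G.Adj u v := by
  classical
  -- The ordered pairs of adjacent vertices off x and C, whose number is minimized. A reroute
  -- uncovers no new edge, so by minimality it misses every vertex of an uncovered edge.
  let E : List V → Finset (V × V) := fun C =>
    Finset.univ.filter fun p => p.1 ∉ x :: C ∧ p.2 ∉ x :: C ∧ G.Adj p.1 p.2
  have hE : ∀ C p q, (p, q) ∈ E C ↔ (p ∉ C ∧ p ≠ x) ∧ (q ∉ C ∧ q ≠ x) ∧ G.Adj p q := by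
    intro C p q
    simp only [E, Finset.mem_filter, Finset.mem_univ, true_and, List.mem_cons, not_or]
    tauto
  obtain ⟨C, ⟨hC, hx⟩, hmin⟩ : ∃ C, (G.IsCyclicList C ∧ x ∉ C) ∧
      ∀ C', G.IsCyclicList C' → x ∉ C' → (E C).card ≤ (E C').card := by
    have hex : ∃ n, ∃ C, (G.IsCyclicList C ∧ x ∉ C) ∧ (E C).card = n :=
      ⟨_, [y, z], ⟨IsCyclicList.mk' (a := y) (b := z) (by simp [ChainFromTo, hyz]) hyz.symm
        (by simp [hyz.ne]), by simp [hyx.symm, hzx.symm]⟩, rfl⟩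
    obtain ⟨C, hC, hn⟩ := Nat.find_spec hex
    exact ⟨C, hC, fun C' h1 h2 => hn ▸ Nat.find_min' hex ⟨C', ⟨h1, h2⟩, rfl⟩⟩
  have hre : ∀ C', G.IsReroute x C C' → ∀ p q, (p ∉ C ∧ p ≠ x) → (q ∉ C ∧ q ≠ x) →
      G.Adj p q → p ∉ C' := by
    rintro C' ⟨h1, h2, h3, h4⟩ p q hp hq hpq hpC'
    refine (hmin C' h1 h2).not_gt (Finset.card_lt_card ?_)
    rw [Finset.ssubset_iff_of_subset]
    · exact ⟨(p, q), (hE _ _ _).2 ⟨hp, hq, hpq⟩, fun h => ((hE _ _ _).1 h).1.1 hpC'⟩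
    · rintro ⟨u, v⟩ huv
      obtain ⟨hu, hv, huv⟩ := (hE _ _ _).1 huv
      have huC : u ∉ C := by
        intro huC
        by_cases hvC : v ∈ C
        · exact h4 u huC v hvC hu.1 hv.1 huv
        · exact h3 u huC hu.1 v hvC hv.2 huv
      have hvC : v ∉ C := fun hvC => h3 v hvC hv.1 u huC hu.2 huv.symm
      exact (hE _ _ _).2 ⟨⟨huC, hu.2⟩, ⟨hvC, hv.2⟩, huv⟩
  refine ⟨C, hC, hx, fun u v hu hv huv => ?_⟩
  simp only [List.mem_cons, not_or] at hu hv
  -- G - x - C on the full vertex set, with the deleted vertices isolated; H is the set reachable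
  -- from u.
  let K : SimpleGraph V :=
    { Adj := fun p q => (p ∉ C ∧ p ≠ x) ∧ (q ∉ C ∧ q ≠ x) ∧ G.Adj p q
      symm := ⟨fun p q h => ⟨h.2.1, h.1, h.2.2.symm⟩⟩
      loopless := ⟨fun p h => h.2.2.ne rfl⟩ }
  have hKG : K ≤ G := fun p q h => h.2.2
  have huvK : K.Adj u v := ⟨⟨hu.2, hu.1⟩, ⟨hv.2, hv.1⟩, huv⟩
  have hnb : ∀ w, K.Reachable u w → ∃ q, K.Adj w q := by
    rintro w ⟨p⟩
    cases p.reverse with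
    | nil => exact ⟨v, huvK⟩
    | cons h _ => exact ⟨_, h⟩
  refine hC.false_of_component hx ht hd (H := Finset.univ.filter fun w => K.Reachable u w)
    ⟨u, by simp, v, by simpa using huvK.reachable, huv⟩ ?_ ?_ ?_ ?_
  · intro w hw
    obtain ⟨q, hq⟩ := hnb w (by simpa using hw)
    exact hq.1
  · intro p hp q hqC hqx hpq
    simp only [Finset.mem_filter, Finset.mem_univ, true_and] at hp ⊢
    obtain ⟨r, hr⟩ := hnb p hp
    exact hp.trans (Adj.reachable (G := K) ⟨hr.1, ⟨hqC, hqx⟩, hpq⟩)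
  · intro p hp q hq
    simp only [Finset.mem_filter, Finset.mem_univ, true_and] at hp hq ⊢
    obtain ⟨w, hw⟩ := (hp.symm.trans hq).exists_isPath
    refine ⟨w.support, ?_, hw.support_nodup, fun r hr => hp.trans (w.takeUntil r hr).reachable⟩
    obtain ⟨h1, h2, h3⟩ := w.chainFromTo_support
    exact ⟨h1, h2, h3.imp fun _ _ h => hKG h⟩
  · intro C' hC' w hw
    obtain ⟨q, hq⟩ := hnb w (by simpa using hw)
    exact hre C' hC' w q hq.1 hq.2.1 hq.2.2

end Dominating

end SimpleGraph

/-! ### A dominating cycle through exactly one of y and z. -/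

namespace SimpleGraph

section Triangle

variable {V : Type*} [DecidableEq V] {G : SimpleGraph V} {C C' : List V} {a x y z : V}

/-- `C` is a cycle avoiding `x` and covering all edges of `G - x`. -/
def IsDominatingCycle (G : SimpleGraph V) (x : V) (C : List V) : Prop :=
  G.IsCyclicList C ∧ x ∉ C ∧ ∀ u v, u ∉ x :: C → v ∉ x :: C → ¬ G.Adj u v

theorem IsDominatingCycle.reroute (hC : G.IsDominatingCycle x C) (h : G.IsReroute x C C') :
    G.IsDominatingCycle x C' := by
  obtain ⟨h1, h2, h3, h4⟩ := h
  refine ⟨h1, h2, fun u v hu hv huv => ?_⟩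
  simp only [List.mem_cons, not_or] at hu hv
  by_cases huC : u ∈ C <;> by_cases hvC : v ∈ C
  · exact h4 u huC v hvC hu.2 hv.2 huv
  · exact h3 u huC hu.2 v hvC hv.1 huv
  · exact h3 v hvC hv.2 u huC hu.1 huv.symm
  · exact hC.2.2 u v (by simp [hu.1, huC]) (by simp [hv.1, hvC]) huv

theorem IsDominatingCycle.mem_or_mem (hC : G.IsDominatingCycle x C) (hxy : G.Adj x y)
    (hxz : G.Adj x z) (hyz : G.Adj y z) : y ∈ C ∨ z ∈ C := by
  by_contra h
  rw [not_or] at h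
  exact hC.2.2 y z (by simp [h.1, hxy.ne']) (by simp [h.2, hxz.ne']) hyz

/-- A partner off C is not adjacent to u because C is dominating; the other cases are rerouting
along the one-vertex path u. -/
theorem IsDominatingCycle.not_adj_partner (hC : G.IsDominatingCycle x C) {u s : V} (hu : u ∉ C)
    (hux : u ≠ x) (hN : ∀ C', G.IsReroute x C C' → u ∉ C') (ha : a ∈ C) (hau : G.Adj a u)
    (hs : G.IsPartner x C (C.formPerm a) s) :
    ¬ G.Adj (C.formPerm a) u ∧ ¬ G.Adj s u := by
  have := hC.1.not_adj_succ_and_partner hC.2.1 ha hs (ChainFromTo.singleton u) (by simp) hau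
    (by simp [hu, hux]) fun C' hC' => ⟨u, by simp, hN C' hC'⟩
  refine ⟨this.1, ?_⟩
  rcases hs with h | ⟨h, -⟩
  · exact hC.2.2 _ _ (by simp [h.1, h.2.1]) (by simp [hu, hux])
  · exact this.2 (h ▸ List.formPerm_apply_mem_of_mem (List.formPerm_apply_mem_of_mem ha))

/-- A reroute cannot miss y, which has the neighbour z off C and x; being dominating again, it
therefore cannot contain z. -/
theorem IsDominatingCycle.not_mem_of_isReroute (hC : G.IsDominatingCycle x C) (hxz : G.Adj x z)
    (hyz : G.Adj y z) (hno : ∀ C, G.IsDominatingCycle x C → y ∈ C → z ∈ C → False)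
    (hy : y ∈ C) (hz : z ∉ C) (h : G.IsReroute x C C') : z ∉ C' := by
  refine hno C' (hC.reroute h) ?_
  by_contra hyC'
  exact h.2.2.1 y hy hyC' z hz hxz.ne' hyz

variable [Fintype V]

/-- On an even cycle x could hang at its neighbour c. -/
theorem IsDominatingCycle.odd_length (hC : G.IsDominatingCycle x C) (ht : G.IsStrictlyTough)
    (h3 : 3 ≤ Fintype.card V) (hnh : ¬ G.IsPrismHamiltonian) {c : V} (hc : c ∈ C)
    (hcx : G.Adj c x) : Odd C.length := by
  rw [← Nat.not_even_iff_odd]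
  exact fun hE => hnh (ht.isPrismHamiltonian_of_even_pendant h3 hC.1 hE hC.2.1 hc hcx hC.2.2)

/-- As z is not adjacent to the successor of y, toughness gives it three neighbours; one differs
from x and y, and domination puts it on C. -/
theorem IsDominatingCycle.exists_second_neighbour (hC : G.IsDominatingCycle x C)
    (ht : G.IsStrictlyTough) (hxz : G.Adj x z) (hyz : G.Adj y z)
    (hno : ∀ C, G.IsDominatingCycle x C → y ∈ C → z ∈ C → False) (hy : y ∈ C) (hz : z ∉ C) :
    ∃ b ∈ C, b ≠ y ∧ G.Adj b z := by
  obtain ⟨s, hs⟩ := exists_isPartner (G := G) x C (C.formPerm y)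
  have hσz : C.formPerm y ≠ z := fun h => hz (h ▸ List.formPerm_apply_mem_of_mem hy)
  have h1 := ht.three_le_card hσz fun h => (hC.not_adj_partner hz hxz.ne'
    (fun C' => hC.not_mem_of_isReroute hxz hyz hno hy hz) hy hyz hs).1 h.symm
  obtain ⟨b, hb, hb'⟩ := Finset.exists_mem_notMem_of_card_lt_card
    (s := {x, y}) (t := G.nbhd {z}) ((Finset.card_le_two).trans_lt h1)
  have hzb : G.Adj z b := by simpa using hb
  simp only [Finset.mem_insert, Finset.mem_singleton, not_or] at hb'
  refine ⟨b, ?_, hb'.2, hzb.symm⟩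
  by_contra hbC
  exact hC.2.2 z b (by simp [hz, hxz.ne']) (by simp [hbC, hb'.1]) hzb

/-- A neighbour `x` of the edge formed by the successor of `a` and its partner is adjacent to the
successor, for otherwise there is an even cycle through `a z x`. -/
theorem IsDominatingCycle.adj_succ_of_mem_edgeNbhd (hC : G.IsDominatingCycle x C)
    (ht : G.IsStrictlyTough) (h3 : 3 ≤ Fintype.card V) (hnh : ¬ G.IsPrismHamiltonian)
    (hO : Odd C.length) {u s : V} (hxu : G.Adj x u) (hu : u ∉ C) (ha : a ∈ C) (hau : G.Adj a u)
    (hs : G.IsPartner x C (C.formPerm a) s) (hsu : s ≠ u)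
    (hx : x ∈ G.edgeNbhd (C.formPerm a) s) : G.Adj (C.formPerm a) x := by
  by_contra hne
  have hsx := (mem_edgeNbhd.1 hx).1.resolve_left hne
  rcases hs with ⟨hsC, hsx', hs⟩ | ⟨rfl, hs⟩
  · obtain ⟨C', hC', hp⟩ := hC.1.exists_insert ha (P := [u, x, s]) (p := u) (q := s)
      (by simp [ChainFromTo, hxu.symm, hsx.symm]) (by simp [hxu.ne', hsx'.symm, hsu.symm])
      (by simp [hu, hC.2.1, hsC]) hau hs.symm
    have hlen := hp.length_eq
    refine hnh (ht.isPrismHamiltonian_of_even h3 hC' ?_ ?_)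
    · rw [hlen, List.length_append]
      obtain ⟨k, hk⟩ := hO
      exact ⟨k + 2, by simp; omega⟩
    · intro p q hp' hq'
      rw [hp.mem_iff] at hp' hq'
      simp only [List.mem_append, List.mem_cons, not_or] at hp' hq'
      exact hC.2.2 p q (by simp; tauto) (by simp; tauto)
  · obtain ⟨C', hC', hp⟩ := hC.1.exists_replace ha (P := [u, x]) (p := u) (q := x)
      (by simp [ChainFromTo, hxu.symm]) (by simp [hxu.ne'])
      (by simp [hu, hC.2.1]) hau hsx.symm
    have hlen := hp.length_eq
    refine hnh (ht.isPrismHamiltonian_of_even h3 hC' ?_ ?_)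
    · rw [List.length_append] at hlen
      obtain ⟨k, hk⟩ := hO
      exact ⟨k + 1, by simp at hlen; omega⟩
    · have key : ∀ p, p ∉ C' → p = C.formPerm a ∨ p ∉ C ∧ p ≠ x := by
        intro p hp'
        by_contra hcon
        rw [not_or, not_and_or, not_not, not_not] at hcon
        have : p ∈ C ++ [u, x] := by simp; tauto
        rw [← hp.mem_iff, List.mem_cons] at this
        tauto
      intro p q hp' hq'
      rcases key p hp' with rfl | h1 <;> rcases key q hq' with rfl | h2
      · exact G.irrefl
      · exact hs q h2.1 h2.2
      · exact fun h => hs p h1.1 h1.2 h.symm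
      · exact hC.2.2 p q (by simp [h1]) (by simp [h2])

theorem IsDominatingCycle.false_of_odd_arc {b : V} {A B : List V}
    (hC : G.IsDominatingCycle x (y :: A ++ b :: B))
    (ht : G.IsStrictlyTough) (hd : G.HasLargeRemoteDegrees) (h3 : 3 ≤ Fintype.card V)
    (hnh : ¬ G.IsPrismHamiltonian) (hxy : G.Adj x y) (hxz : G.Adj x z) (hyz : G.Adj y z)
    (hno : ∀ C, G.IsDominatingCycle x C → y ∈ C → z ∈ C → False)
    (hz : z ∉ y :: A ++ b :: B) (hbz : G.Adj b z) (hA : Odd A.length) : False := by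
  set C := y :: A ++ b :: B with hCdef
  have hy : y ∈ C := by simp [hCdef]
  have hb : b ∈ C := by simp [hCdef]
  have hyb : y ≠ b := by
    have := hC.1.1
    rw [hCdef, List.cons_append, List.nodup_cons] at this
    rintro rfl
    exact this.1 (by simp)
  have hO := hC.odd_length ht h3 hnh hy hxy.symm
  have hN : ∀ C', G.IsReroute x C C' → z ∉ C' := fun C' =>
    hC.not_mem_of_isReroute hxz hyz hno hy hz
  obtain ⟨s, hs⟩ := exists_isPartner (G := G) x C (C.formPerm y)
  obtain ⟨t, ht'⟩ := exists_isPartner (G := G) x C (C.formPerm b)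
  have hny := hC.not_adj_partner hz hxz.ne' hN hy hyz hs
  have hnb := hC.not_adj_partner hz hxz.ne' hN hb hbz ht'
  have hσy : C.formPerm y ∈ C := List.formPerm_apply_mem_of_mem hy
  have hσb : C.formPerm b ∈ C := List.formPerm_apply_mem_of_mem hb
  obtain ⟨hrem, -, hcnt⟩ := hC.1.remote_partners hC.2.1 hy hb hyb hs ht'
    (ChainFromTo.singleton z) (by simp) hyz hbz.symm (H := {z}) (by simp)
    (by simp [hz, hxz.ne']) (by simpa using hny) (by simpa using hnb)
    fun C' hC' => ⟨z, by simp, hN C' hC'⟩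
  have hdeg := hd _ _ _ _ (hs.adj hC.1 hσy) (ht'.adj hC.1 hσb) hrem
  have hsdiff : ∀ N : Finset V, x ∉ N → (N \ {x}).card = N.card := fun N h => by
    rw [Finset.sdiff_singleton_eq_erase, Finset.erase_eq_of_notMem h]
  have hsz : ∀ f s, f ∈ C → G.IsPartner x C f s → ¬ G.Adj f z → s ≠ z := fun f s hf h h' e =>
    h' (e ▸ h.adj hC.1 hf)
  -- The crossing bound with H = {z} contradicts the degree condition unless x lies in one of the
  -- two edge neighbourhoods. On the side of y this would let x be inserted behind y, giving an even
  -- cycle.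
  have hxσ : G.Adj (C.formPerm b) x := by
    have hxyn : x ∉ G.edgeNbhd (C.formPerm y) s := by
      intro hx
      have hadj := hC.adj_succ_of_mem_edgeNbhd ht h3 hnh hO hxz hz hy hyz hs
        (hsz _ _ hσy hs hny.1) hx
      obtain ⟨C', hC', hp⟩ := hC.1.exists_insert hy (ChainFromTo.singleton x) (by simp)
        (by simpa using hC.2.1) hxy.symm hadj.symm
      refine hnh (ht.isPrismHamiltonian_of_even h3 hC' ?_ ?_)
      · rw [hp.length_eq, List.length_append, List.length_singleton]
        exact hO.add_one
      · intro p q hp' hq'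
        rw [hp.mem_iff] at hp' hq'
        simp only [List.mem_append, List.mem_singleton, not_or] at hp' hq'
        exact hC.2.2 p q (by simp only [List.mem_cons]; tauto) (by simp only [List.mem_cons]; tauto)
    refine hC.adj_succ_of_mem_edgeNbhd ht h3 hnh hO hxz hz hb hbz ht' (hsz _ _ hσb ht' hnb.1) ?_
    by_contra hxbn
    rw [hsdiff _ hxyn, hsdiff _ hxbn, Finset.card_singleton] at hcnt
    omega
  have hr : C ~r b :: (B ++ y :: A) := by
    rw [hCdef]
    simpa using List.isRotated_append (l := y :: A) (l' := b :: B)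
  rcases B with _ | ⟨d, B⟩
  · have := hC.1.formPerm_of_rotated_cons (by simpa using hr)
    exact hnb.1 (this ▸ hyz)
  have hd' : C.formPerm b = d := hC.1.formPerm_of_rotated_cons (by simpa using hr)
  rw [hd'] at hxσ
  obtain ⟨e, hce, hey⟩ := hC.1.chain
  obtain ⟨h1, -, h2⟩ := ChainFromTo.split (L := y :: A) (by simpa using hce)
  rcases A with _ | ⟨c, A⟩
  · simp at hA
  obtain ⟨hyc, h4⟩ := ChainFromTo.tail (by simpa using h1)
  have hperm : (y :: (c :: (A ++ [b]) ++ [z] ++ x :: d :: B)).Perm (z :: x :: C) := by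
    rw [List.perm_iff_count, hCdef]
    intro v
    simp only [List.count_cons, List.count_append, List.count_nil, List.cons_append]
    omega
  -- Two odd cycles meet in y: one runs along the arc A to b and back over z, the other over x to
  -- the successor d of b and along the rest of C. The second is odd because |C| and |A| are.
  refine hnh (ht.isPrismHamiltonian_of_two_odd h3 (h4.append (ChainFromTo.singleton z) hbz)
    (h2.cons hxσ.symm) hyc hyz.symm hxy.symm hey ?_ ?_ ?_ ?_)
  · simp only [List.length_append, List.length_cons, List.length_nil] at hA ⊢
    exact (hA.add_even even_two)
  · simp only [hCdef, List.length_append, List.length_cons] at hA hO ⊢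
    rw [Nat.odd_iff] at hA hO ⊢
    omega
  · rw [hperm.nodup_iff, List.nodup_cons, List.nodup_cons]
    exact ⟨by simp only [List.mem_cons, not_or]; exact ⟨hxz.ne', hz⟩, hC.2.1, hC.1.1⟩
  · intro p q hp hq
    rw [hperm.mem_iff] at hp hq
    exact hC.2.2 p q (fun h => hp (List.mem_cons_of_mem _ h)) fun h =>
      hq (List.mem_cons_of_mem _ h)

/-- As |C| is odd, exactly one of the arcs between y and b has an odd number of inner vertices;
reversing C if necessary makes it the arc from y to b. -/
theorem IsDominatingCycle.false_of_mem_not_mem (hC : G.IsDominatingCycle x C)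
    (ht : G.IsStrictlyTough) (hd : G.HasLargeRemoteDegrees) (h3 : 3 ≤ Fintype.card V)
    (hnh : ¬ G.IsPrismHamiltonian) (hxy : G.Adj x y) (hxz : G.Adj x z) (hyz : G.Adj y z)
    (hno : ∀ C, G.IsDominatingCycle x C → y ∈ C → z ∈ C → False) (hy : y ∈ C) (hz : z ∉ C) :
    False := by
  have hO := hC.odd_length ht h3 hnh hy hxy.symm
  obtain ⟨b, hb, hby, hbz⟩ := hC.exists_second_neighbour ht hxz hyz hno hy hz
  have hperm : ∀ C', C.Perm C' → G.IsCyclicList C' → G.IsDominatingCycle x C' := by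
    intro C' hp hC'
    refine ⟨hC', fun h => hC.2.1 (hp.mem_iff.2 h), fun u v hu hv => hC.2.2 u v ?_ ?_⟩
    · exact fun h => hu ((hp.cons x).mem_iff.1 h)
    · exact fun h => hv ((hp.cons x).mem_iff.1 h)
  obtain ⟨K, hr, hK⟩ := hC.1.exists_rotation_first hy
  have hbK : b ∈ K := by
    have := hr.mem_iff.1 hb
    simpa [hby] using this
  obtain ⟨A, B, rfl⟩ := List.append_of_mem hbK
  rw [← List.cons_append] at hK hr
  rcases Nat.even_or_odd A.length with hA | hA
  · have hrev : (y :: A ++ b :: B).Perm (y :: B.reverse ++ b :: A.reverse) := by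
      rw [List.perm_iff_count]
      intro v
      simp only [List.count_cons, List.count_append, List.cons_append, List.count_reverse]
      omega
    have hK' : G.IsCyclicList (y :: B.reverse ++ b :: A.reverse) := by
      have h1 : G.IsCyclicList ((B.reverse ++ b :: A.reverse) ++ [y]) := by simpa using hK.reverse
      simpa using h1.rotate_append
    have hp := hr.perm.trans hrev
    refine (hperm _ hp hK').false_of_odd_arc ht hd h3 hnh hxy hxz hyz hno
      (fun h => hz (hp.mem_iff.2 h)) hbz ?_
    rw [hr.perm.length_eq] at hO
    simp only [List.length_append, List.length_cons, List.length_reverse, Nat.odd_iff,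
      Nat.even_iff] at hA hO ⊢
    omega
  · exact (hperm _ hr.perm hK).false_of_odd_arc ht hd h3 hnh hxy hxz hyz hno
      (fun h => hz (hr.mem_iff.2 h)) hbz hA

end Triangle

end SimpleGraph

/-! ### A dominating cycle through both y and z, and the conclusion. -/

namespace SimpleGraph

section Tight

variable {V : Type*} [Fintype V] [DecidableEq V] {G : SimpleGraph V} {C : List V} {x y z : V}

/-- The vertices outside `x` and `C`. -/
def offCycle (x : V) (C : List V) : Finset V := (x :: C).toFinsetᶜ

theorem mem_offCycle {v : V} : v ∈ offCycle x C ↔ v ∉ C ∧ v ≠ x := by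
  simp only [offCycle, Finset.mem_compl, List.mem_toFinset, List.mem_cons, not_or]
  exact and_comm

theorem IsDominatingCycle.not_adj_offCycle (hC : G.IsDominatingCycle x C) {u v : V}
    (hu : u ∈ offCycle x C) (hv : v ∈ offCycle x C) : ¬ G.Adj u v := by
  rw [mem_offCycle] at hu hv
  exact hC.2.2 u v (by simp [hu]) (by simp [hv])

theorem IsDominatingCycle.card_offCycle (hC : G.IsDominatingCycle x C) :
    (offCycle x C).card + C.length + 1 = Fintype.card V := by
  have h1 := Finset.card_add_card_compl (x :: C).toFinset
  rw [List.toFinset_card_of_nodup (List.nodup_cons.2 ⟨hC.2.1, hC.1.1⟩), List.length_cons] at h1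
  rw [offCycle]
  omega

/-- The off-cycle vertices are independent with all neighbours among the |C| + 1 vertices of `x ::
C`. -/
theorem IsDominatingCycle.card_offCycle_le (hC : G.IsDominatingCycle x C)
    (ht : G.IsStrictlyTough) (h3 : 3 ≤ Fintype.card V) : (offCycle x C).card ≤ C.length := by
  rcases (offCycle x C).eq_empty_or_nonempty with h | h
  · simp [h]
  have h1 := ht.card_add_one_le h3 h fun u hu v hv => hC.not_adj_offCycle hu hv
  have h2 : G.nbhd (offCycle x C) ⊆ (x :: C).toFinset := by
    intro v hv
    rw [mem_nbhd] at hv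
    obtain ⟨u, hu, huv⟩ := hv
    by_contra hv
    exact hC.not_adj_offCycle hu (by rwa [offCycle, Finset.mem_compl]) huv
  have h4 := Finset.card_le_card h2
  rw [List.toFinset_card_of_nodup (List.nodup_cons.2 ⟨hC.2.1, hC.1.1⟩), List.length_cons] at h4
  omega

open Classical in
-- If v has at most one off-cycle neighbour w, delete x and C except v. These are |C| vertices, and
-- |C| components remain: v joins that of w, or is given the label of an arbitrary w.
theorem IsDominatingCycle.two_le_card_filter (hC : G.IsDominatingCycle x C)
    (ht : G.IsStrictlyTough) (hcard : (offCycle x C).card = C.length) {v : V} (hv : v ∈ C) :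
    2 ≤ ((offCycle x C).filter fun u => G.Adj v u).card := by
  by_contra hlt
  have h2 := hC.1.two_le_length
  have hone : ∀ p ∈ (offCycle x C).filter (fun u => G.Adj v u),
      ∀ q ∈ (offCycle x C).filter (fun u => G.Adj v u), p = q :=
    Finset.card_le_one.1 (by omega)
  simp only [Finset.mem_filter] at hone
  obtain ⟨w, hw, hw'⟩ : ∃ w ∈ offCycle x C, ∀ u ∈ offCycle x C, G.Adj v u → u = w := by
    by_cases hex : ∃ w ∈ offCycle x C, G.Adj v w
    · obtain ⟨w, hw, hvw⟩ := hex
      exact ⟨w, hw, fun u hu hvu => hone u ⟨hu, hvu⟩ w ⟨hw, hvw⟩⟩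
    · push Not at hex
      obtain ⟨w, hw⟩ : (offCycle x C).Nonempty := Finset.card_pos.1 (by omega)
      exact ⟨w, hw, fun u hu hvu => absurd hvu (hex u hu)⟩
  have hout : ∀ u, u ∉ (x :: C).toFinset.erase v → u = v ∨ u ∈ offCycle x C := by
    intro u hu
    rw [Finset.mem_erase, not_and_or, not_not] at hu
    exact hu.imp id fun h => by rwa [offCycle, Finset.mem_compl]
  have hvo : v ∉ offCycle x C := fun h => (mem_offCycle.1 h).1 hv
  have := ht.card_lt (S := (x :: C).toFinset.erase v) (κ := offCycle x C)
    (fun u => if hu : u ∈ offCycle x C then ⟨u, hu⟩ else ⟨w, hw⟩) ?_ ?_ (by simp; omega)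
  · rw [Finset.card_erase_of_mem (by simp [hv]),
      List.toFinset_card_of_nodup (List.nodup_cons.2 ⟨hC.2.1, hC.1.1⟩), List.length_cons,
      Fintype.card_coe] at this
    omega
  · intro p q hp hq hpq
    rcases hout p hp with rfl | hp' <;> rcases hout q hq with rfl | hq'
    · rfl
    · rw [dif_neg hvo, dif_pos hq']
      exact Subtype.ext (hw' q hq' hpq).symm
    · rw [dif_neg hvo, dif_pos hp']
      exact Subtype.ext (hw' p hp' hpq.symm)
    · exact absurd hpq (hC.not_adj_offCycle hp' hq')
  · rintro ⟨u, hu⟩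
    refine ⟨u, ?_, by simp [hu]⟩
    rw [Finset.mem_erase]
    rw [offCycle, Finset.mem_compl] at hu
    exact fun h => hu h.2

/-- Otherwise choose distinct off-cycle neighbours u of a and w of its successor; inserting u, x, w
between the two gives an even cycle of length |C| + 3. -/
theorem IsDominatingCycle.exists_not_adj_offCycle (hC : G.IsDominatingCycle x C)
    (ht : G.IsStrictlyTough) (h3 : 3 ≤ Fintype.card V) (hnh : ¬ G.IsPrismHamiltonian)
    (hO : Odd C.length) (hcard : (offCycle x C).card = C.length) :
    ∃ u ∈ offCycle x C, ¬ G.Adj u x := by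
  classical
  by_contra hcon
  push Not at hcon
  obtain ⟨-, a, b, hab, -⟩ := id hC.1
  have ha := hab.head_mem
  have hσ : C.formPerm a ∈ C := List.formPerm_apply_mem_of_mem ha
  obtain ⟨u, hu⟩ := Finset.card_pos.1 (two_pos.trans_le (hC.two_le_card_filter ht hcard ha))
  obtain ⟨w, hw, hwu⟩ := Finset.exists_mem_ne
    (one_lt_two.trans_le (hC.two_le_card_filter ht hcard hσ)) u
  rw [Finset.mem_filter] at hu hw
  have hu' := mem_offCycle.1 hu.1
  have hw' := mem_offCycle.1 hw.1
  obtain ⟨C', hC', hp⟩ := hC.1.exists_insert ha (P := [u, x, w]) (p := u) (q := w)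
    (by simp [ChainFromTo, hcon u hu.1, (hcon w hw.1).symm])
    (by simp [hu'.2, hw'.2.symm, hwu.symm]) (by simp [hu'.1, hC.2.1, hw'.1]) hu.2 hw.2.symm
  refine hnh (ht.isPrismHamiltonian_of_even h3 hC' ?_ ?_)
  · rw [hp.length_eq, List.length_append]
    obtain ⟨k, hk⟩ := hO
    exact ⟨k + 2, by simp; omega⟩
  · intro p q hp' hq'
    rw [hp.mem_iff] at hp' hq'
    simp only [List.mem_append, List.mem_cons, not_or] at hp' hq'
    exact hC.2.2 p q (by simp; tauto) (by simp; tauto)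

open Classical in
-- Take off-cycle partners and let H consist of the off-cycle vertices adjacent to neither
-- successor. The crossing bound and the degree condition give |H| ≤ 2, and the other off-cycle
-- vertices are adjacent to one of the successors.
theorem IsDominatingCycle.disjoint_filter_and_length_le (hC : G.IsDominatingCycle x C)
    (ht : G.IsStrictlyTough) (hd : G.HasLargeRemoteDegrees)
    (hcard : (offCycle x C).card = C.length) {u a b : V} (hu : u ∈ offCycle x C)
    (hN : ∀ C', G.IsReroute x C C' → u ∉ C') (ha : a ∈ C) (hb : b ∈ C) (hab : a ≠ b)
    (hau : G.Adj a u) (hbu : G.Adj b u) :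
    Disjoint ((offCycle x C).filter fun v => G.Adj (C.formPerm a) v)
        ((offCycle x C).filter fun v => G.Adj (C.formPerm b) v) ∧
      u ∉ (offCycle x C).filter (fun v => G.Adj (C.formPerm a) v) ∧
      C.length ≤ ((offCycle x C).filter fun v => G.Adj (C.formPerm a) v).card +
        ((offCycle x C).filter fun v => G.Adj (C.formPerm b) v).card + 2 := by
  have hu' := mem_offCycle.1 hu
  have hσ : ∀ a ∈ C, C.formPerm a ∈ C := fun a ha => List.formPerm_apply_mem_of_mem ha
  have hex : ∀ a ∈ C, ∃ s ∈ offCycle x C, G.Adj (C.formPerm a) s := by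
    intro a ha
    obtain ⟨s, hs⟩ :=
      Finset.card_pos.1 (two_pos.trans_le (hC.two_le_card_filter ht hcard (hσ a ha)))
    exact ⟨s, Finset.mem_filter.1 hs⟩
  obtain ⟨s, hs, has⟩ := hex a ha
  obtain ⟨t, ht', hbt⟩ := hex b hb
  have hps : G.IsPartner x C (C.formPerm a) s :=
    Or.inl ⟨(mem_offCycle.1 hs).1, (mem_offCycle.1 hs).2, has⟩
  have hpt : G.IsPartner x C (C.formPerm b) t :=
    Or.inl ⟨(mem_offCycle.1 ht').1, (mem_offCycle.1 ht').2, hbt⟩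
  have hna := (hC.not_adj_partner hu'.1 hu'.2 hN ha hau hps).1
  have hnb := (hC.not_adj_partner hu'.1 hu'.2 hN hb hbu hpt).1
  set H := (offCycle x C).filter fun v => ¬ G.Adj (C.formPerm a) v ∧ ¬ G.Adj (C.formPerm b) v
    with hH
  obtain ⟨hrem, hcom, hcnt⟩ := hC.1.remote_partners hC.2.1 ha hb hab hps hpt
    (ChainFromTo.singleton u) (by simp) hau hbu.symm (H := H) (by simp [hH, hu, hna, hnb])
    (fun v hv => mem_offCycle.1 (Finset.mem_filter.1 hv).1)
    (fun v hv => ⟨(Finset.mem_filter.1 hv).2.1,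
      hC.not_adj_offCycle hs (Finset.mem_filter.1 hv).1⟩)
    (fun v hv => ⟨(Finset.mem_filter.1 hv).2.2,
      hC.not_adj_offCycle ht' (Finset.mem_filter.1 hv).1⟩)
    fun C' hC' => ⟨u, by simp, hN C' hC'⟩
  have hdeg := hd _ _ _ _ has hbt hrem
  refine ⟨?_, by simp [hna], ?_⟩
  · rw [Finset.disjoint_left]
    intro v hv hv'
    rw [Finset.mem_filter] at hv hv'
    have hvo := mem_offCycle.1 hv.1
    refine hcom v hvo.1 hvo.2 (by rw [List.mem_singleton]; rintro rfl; exact hna hv.2) ?_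
    rw [mem_edgeNbhd, mem_edgeNbhd]
    refine ⟨⟨Or.inl hv.2, hv.2.ne', ?_⟩, ⟨Or.inl hv'.2, hv'.2.ne', ?_⟩⟩
    · rintro rfl
      exact (hrem v (C.formPerm b) (Or.inr rfl) (Or.inl rfl)).2 hv'.2.symm
    · rintro rfl
      exact (hrem (C.formPerm a) v (Or.inl rfl) (Or.inr rfl)).2 hv.2
  · have k1 := card_le_card_sdiff_singleton_add_one (G.edgeNbhd (C.formPerm a) s) x
    have k2 := card_le_card_sdiff_singleton_add_one (G.edgeNbhd (C.formPerm b) t) x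
    have k3 := hC.card_offCycle
    have k4 : offCycle x C ⊆ (H ∪ (offCycle x C).filter fun v => G.Adj (C.formPerm a) v) ∪
        (offCycle x C).filter fun v => G.Adj (C.formPerm b) v := by
      intro v hv
      simp only [hH, Finset.mem_union, Finset.mem_filter]
      tauto
    have k5 := (Finset.card_le_card k4).trans ((Finset.card_union_le _ _).trans
      (Nat.add_le_add_right (Finset.card_union_le _ _) _))
    omega

theorem IsDominatingCycle.false_of_mem_mem (hC : G.IsDominatingCycle x C)
    (ht : G.IsStrictlyTough) (hd : G.HasLargeRemoteDegrees) (h3 : 3 ≤ Fintype.card V)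
    (hnh : ¬ G.IsPrismHamiltonian) (hxy : G.Adj x y) (hxz : G.Adj x z) (hyz : G.Adj y z)
    (hy : y ∈ C) (hz : z ∈ C) : False := by
  classical
  have hO := hC.odd_length ht h3 hnh hy hxy.symm
  have hbig : ∀ C', G.IsDominatingCycle x C' → y ∈ C' → z ∈ C' →
      2 * C'.length < Fintype.card V := by
    intro C' hC' hy hz
    by_contra hle
    exact hnh (ht.isPrismHamiltonian_of_odd_triangle h3 hC'.1
      (hC'.odd_length ht h3 hnh hy hxy.symm) hC'.2.1 hy hz hxy hxz hyz hC'.2.2 (by omega))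
  have hcard : (offCycle x C).card = C.length := by
    have := hC.card_offCycle
    have := hC.card_offCycle_le ht h3
    have := hbig C hC hy hz
    omega
  obtain ⟨u, hu, hux⟩ := hC.exists_not_adj_offCycle ht h3 hnh hO hcard
  have hu' := mem_offCycle.1 hu
  -- Each vertex of C has an off-cycle neighbour, so a reroute keeps all of C; containing u as well,
  -- it would be too long for `hbig`.
  have hN : ∀ C', G.IsReroute x C C' → u ∉ C' := by
    intro C' hC' huC'
    have hsub : ∀ v ∈ C, v ∈ C' := by
      intro v hv
      by_contra hv'
      obtain ⟨w, hw⟩ := Finset.card_pos.1 (two_pos.trans_le (hC.two_le_card_filter ht hcard hv))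
      rw [Finset.mem_filter] at hw
      have hwo := mem_offCycle.1 hw.1
      exact hC'.2.2.1 v hv hv' w hwo.1 hwo.2 hw.2
    have hle : (u :: C).length ≤ C'.length := by
      refine ((List.nodup_cons.2 ⟨hu'.1, hC.1.1⟩).subperm fun v hv => ?_).length_le
      rcases List.mem_cons.1 hv with rfl | hv
      exacts [huC', hsub v hv]
    have h1 := hbig C' (hC.reroute hC') (hsub y hy) (hsub z hz)
    have h2 := hC.card_offCycle
    rw [List.length_cons] at hle
    omega
  obtain ⟨a, b, c, ha, hb, hc, hab, hac, hbc⟩ := Finset.two_lt_card_iff.1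
    (Nat.lt_of_lt_of_le (by norm_num) (ht.three_le_card hu'.2.symm hux))
  simp only [mem_nbhd, Finset.mem_singleton, exists_eq_left] at ha hb hc
  have hCu : ∀ v, G.Adj u v → v ∈ C := by
    intro v hv
    by_contra hvC
    exact hC.not_adj_offCycle hu (mem_offCycle.2 ⟨hvC, by rintro rfl; exact hux hv⟩) hv
  obtain ⟨d1, n1, l1⟩ := hC.disjoint_filter_and_length_le ht hd hcard hu hN (hCu a ha) (hCu b hb)
    hab ha.symm hb.symm
  obtain ⟨d2, n2, l2⟩ := hC.disjoint_filter_and_length_le ht hd hcard hu hN (hCu b hb) (hCu c hc)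
    hbc hb.symm hc.symm
  obtain ⟨d3, n3, l3⟩ := hC.disjoint_filter_and_length_le ht hd hcard hu hN (hCu c hc) (hCu a ha)
    hac.symm hc.symm ha.symm
  have key : ∀ a, G.Adj u a →
      2 ≤ ((offCycle x C).filter fun v => G.Adj (C.formPerm a) v).card := fun a ha =>
    hC.two_le_card_filter ht hcard (List.formPerm_apply_mem_of_mem (hCu a ha))
  have ka := key a ha
  have kb := key b hb
  have kc := key c hc
  have hsub : ((offCycle x C).filter fun v => G.Adj (C.formPerm a) v) ∪
      ((offCycle x C).filter fun v => G.Adj (C.formPerm b) v) ∪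
      ((offCycle x C).filter fun v => G.Adj (C.formPerm c) v) ⊆ (offCycle x C).erase u := by
    intro v hv
    rw [Finset.mem_erase]
    refine ⟨?_, ?_⟩
    · rintro rfl
      simp only [Finset.mem_union] at hv
      tauto
    · simp only [Finset.mem_union, Finset.mem_filter] at hv
      tauto
  have hle := Finset.card_le_card hsub
  rw [Finset.card_erase_of_mem hu, Finset.card_union_of_disjoint
    (Finset.disjoint_union_left.2 ⟨d3.symm, d2⟩), Finset.card_union_of_disjoint d1] at hle
  -- The three disjoint sets miss u and so have at most |C| - 1 elements together. Any two have at
  -- least |C| - 2, which leaves at most 1 for the third.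
  omega

theorem IsStrictlyTough.isPrismHamiltonian (ht : G.IsStrictlyTough)
    (hd : G.HasLargeRemoteDegrees) (h3 : 3 ≤ Fintype.card V) (h5 : G.IsKChordal 5) :
    G.IsPrismHamiltonian := by
  by_contra hnh
  obtain ⟨x, y, z, hxy, hyz, hxz⟩ := exists_triangle_of_not_colorable (ht.not_colorable_two h3) h5
  have hno : ∀ C, G.IsDominatingCycle x C → y ∈ C → z ∈ C → False := fun C hC =>
    hC.false_of_mem_mem ht hd h3 hnh hxy hxz hyz
  obtain ⟨C, hC⟩ : ∃ C, G.IsDominatingCycle x C :=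
    ht.exists_dominating_cycle hd hxy.ne' hxz.ne' hyz
  rcases hC.mem_or_mem hxy hxz hyz with h | h
  · exact hC.false_of_mem_not_mem ht hd h3 hnh hxy hxz hyz hno h fun h' => hno C hC h h'
  · exact hC.false_of_mem_not_mem ht hd h3 hnh hxz hxy hyz.symm (fun C hC h1 h2 => hno C hC h2 h1) h
      fun h' => hno C hC h' h

/-- A strictly tough graph on two vertices is an edge. -/
theorem IsStrictlyTough.isPrismHamiltonian_of_card_eq_two (ht : G.IsStrictlyTough)
    (h2 : Fintype.card V = 2) : G.IsPrismHamiltonian := by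
  obtain ⟨a, b, hab, huniv⟩ := Finset.card_eq_two.1 (Finset.card_univ.trans h2)
  have hmem : ∀ v, v = a ∨ v = b := fun v => by
    have : v ∈ (Finset.univ : Finset V) := Finset.mem_univ v
    simpa [huniv] using this
  have : Nontrivial V := ⟨a, b, hab⟩
  have hadj : G.Adj a b := by
    by_contra hcon
    -- Without the edge, deleting nothing would leave two components.
    have := ht.card_lt (S := ∅) (κ := V) id ?_ (fun k => ⟨k, by simp⟩) h2.ge
    · simp at this
    · intro u v _ _ huv
      rcases hmem u with rfl | rfl <;> rcases hmem v with rfl | rfl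
      exacts [rfl, absurd huv hcon, absurd huv.symm hcon, rfl]
  refine isPrismHamiltonian_of_even_cycle (C := [a, b]) (h := fun v => [v])
    (IsCyclicList.mk' (a := a) (b := b) (by simp [ChainFromTo, hadj]) hadj.symm (by simp [hab]))
    (by simp) (fun v => by simp) fun v => ?_
  rcases hmem v with rfl | rfl <;> simp [hab, hab.symm]

end Tight

end SimpleGraph

theorem mainTheorem5 {V : Type*} [Fintype V] [DecidableEq V] [Nontrivial V]
    (G : SimpleGraph V) (ε : ℝ) (hε : 0 < ε)
    (htough : G.IsTough (1 + ε)) (hchordal : G.IsKChordal 5)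
    (hdeg : ∀ e₁ e₂ : Sym2 V, G.AreRemoteEdges e₁ e₂ →
      (G.edgeDegree e₁ : ℤ) + (G.edgeDegree e₂ : ℤ) > (Fintype.card V : ℤ) - 4) :
    G.IsPrismHamiltonian := by
  have ht := htough.isStrictlyTough hε
  -- In integers, a degree sum above |V| - 4 means |V| ≤ d(e₁) + d(e₂) + 3.
  have hd : G.HasLargeRemoteDegrees := by
    intro u v w z huv hwz h
    have := hdeg s(u, v) s(w, z) ⟨huv, hwz, fun a ha b hb =>
      h a b (Sym2.mem_iff.1 ha) (Sym2.mem_iff.1 hb)⟩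
    rw [SimpleGraph.edgeDegree_eq_card, SimpleGraph.edgeDegree_eq_card] at this
    omega
  have h2 : 1 < Fintype.card V := Fintype.one_lt_card
  by_cases h3 : 3 ≤ Fintype.card V
  · exact ht.isPrismHamiltonian hd h3 hchordal
  · exact ht.isPrismHamiltonian_of_card_eq_two (by omega)
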